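/- Let $X\subset\mathbb{C}^n$ be a domain, i.e. a non-empty open connected set. A function $K:X\times X\to\mathbb{C}$ is called sesqui-holomorphic if it is holomorphic in the first variable and antiholomorphic in the second, non-degenerate if $K(x,x)>0$ for all $x\in X$, and positive semi-definite if for all $x_1,\dots,x_m\in X$ the matrix $(K(x_i,x_j))_{i,j=1}^m$ is positive semi-definite. Two non-degenerate functions $K,L$ on $X\times X$ are called rescalings of each other if there is a function $\omega:X\to\mathbb{C}$ such that $K(x,y)=\omega(x)\overline{\omega(y)}L(x,y)$ for all $x,y\in X$ (a symmetric relation). For a positive semi-definite kernel $K$ let $F$ be the reproducing kernel Hilbert space on $X$ with kernel $K$, let $F^*$ be its dual Hilbert space, and let $\kappa:X\to F^*$, $\kappa(x)f=f(x)$, be the evaluation map, so that $K(x,y)=\langle\kappa(x),\kappa(y)\rangle_{F^*}$ (inner products are linear in the first argument). For $g,h\in F^*\setminus\{0\}$ and $f_1,f_2\in F^*$ put $$\tilde\sigma_g(f_1,f_2)=\frac{\langle f_1,f_2\rangle}{\|g\|^2}-\frac{\langle f_1,g\rangle\langle g,f_2\rangle}{\|g\|^4},\qquad \delta_1(g,h)=\sqrt{1-\frac{|\langle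 g,h\rangle|^2}{\|g\|^2\|h\|^2}},\qquad \delta_2(g,h)=\sqrt{2-2\frac{|\langle g,h\rangle|}{\|g\|\|h\|}}.$$ If $K$ is moreover sesqui-holomorphic and non-degenerate, let $\tilde\sigma^K,\delta_1^K,\delta_2^K$ be the pull-backs of these through $\kappa$: $$\tilde\sigma^K_x(u,v)=\tilde\sigma_{\kappa(x)}(D\kappa_x u,D\kappa_x v),\qquad \delta_i^K(x,y)=\delta_i(\kappa(x),\kappa(y))\quad(i=1,2),$$ for $x,y\in X$ and $u,v\in\mathbb{C}^n$, where $D\kappa_x$ is the complex differential of the (holomorphic) map $\kappa$ at $x$. Let $K$ and $L$ be sesqui-holomorphic, non-degenerate, positive semi-definite kernels on $X$. Then the following are equivalent: (i) $K$ and $L$ are rescalings of each other; (ii) $\tilde\sigma^K=\tilde\sigma^L$ on $X$; (iii) $\delta_1^K=\delta_1^L$ on $X\times X$; (iv) $\delta_2^K=\delta_2^L$ on $X\times X$. -/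

import Mathlib

open scoped ComplexOrder ComplexConjugate InnerProductSpace

noncomputable section

namespace KernelMetric

/-! ### Functions of two variables on a set -/

section Kernels

variable {X : Type*}

/-- `L` is non-degenerate: its diagonal values are real and strictly positive. -/
def IsNondegenerate (L : X → X → ℂ) : Prop :=
  ∀ x, 0 < L x x

/-- `M` is a rescaling of `L`: there is `ω : X → ℂ` with `M(x, y) = ω(x) conj(ω(y)) L(x, y)`. -/
def IsRescaling (M L : X → X → ℂ) : Prop :=
  ∃ ω : X → ℂ, ∀ x y, M x y = ω x * conj (ω y) * L x y

/-- `L` and `M` are rescalings if one of them is a rescaling of the other. -/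
def AreRescalings (L M : X → X → ℂ) : Prop :=
  IsRescaling M L ∨ IsRescaling L M

/-- Positive semi-definite kernels: every matrix `(K(x_i, x_j))`, for finitely many points
`x_1, …, x_m` of `X`, is (Hermitian and) positive semi-definite. -/
def IsPosSemidefKernel (K : X → X → ℂ) : Prop :=
  ∀ (m : ℕ) (p : Fin m → X), (Matrix.of fun i j => K (p i) (p j)).PosSemidef

/-- The scalar kernel `K` seen as a kernel with values in the operators on `ℂ`, which is the form
in which Mathlib's reproducing kernel Hilbert spaces take it. -/
def opKernel (K : X → X → ℂ) : Matrix X X (ℂ →L[ℂ] ℂ) :=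
  Matrix.of fun x y => K x y • (1 : ℂ →L[ℂ] ℂ)

theorem IsPosSemidefKernel.conj_symm {K : X → X → ℂ} (hK : IsPosSemidefKernel K) (x y : X) :
    conj (K y x) = K x y := by
  have h := (hK 2 ![x, y]).isHermitian.apply 0 1
  simpa using h

theorem IsPosSemidefKernel.opKernel_posSemidef {K : X → X → ℂ} (hK : IsPosSemidefKernel K) :
    (opKernel K).PosSemidef := by
  have key : (opKernel K).IsHermitian ∧ ∀ f : X →₀ ℂ,
      0 ≤ RCLike.re (f.sum fun x w => f.sum fun x' w' => ⟪opKernel K x' x w, w'⟫_ℂ) := by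
    refine ⟨?_, fun f => ?_⟩
    · ext x y
      have h := hK.conj_symm x y
      simp [opKernel, Matrix.conjTranspose_apply, h]
    · let e := f.support.equivFin
      have h := (hK f.support.card fun i => (e.symm i : X)).dotProduct_mulVec_nonneg
        fun i => f (e.symm i)
      have h' : (f.sum fun x w => f.sum fun x' w' => ⟪opKernel K x' x w, w'⟫_ℂ) =
          star (fun i => f (e.symm i)) ⬝ᵥ
            (Matrix.of fun i j => K (e.symm i : X) (e.symm j)).mulVec fun i => f (e.symm i) := by
        simp only [Finsupp.sum, dotProduct, Matrix.mulVec, Matrix.of_apply, Pi.star_apply]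
        rw [← Finset.sum_coe_sort, ← Equiv.sum_comp e.symm]
        refine Finset.sum_congr rfl fun i _ => ?_
        rw [← Finset.sum_coe_sort, ← Equiv.sum_comp e.symm, Finset.mul_sum]
        refine Finset.sum_congr rfl fun j _ => ?_
        simp [opKernel, hK.conj_symm]
        ring
      rw [h']
      exact (Complex.nonneg_iff.mp h).1
  exact ((RKHS.posSemidef_tfae (K := opKernel K)).out 0 2).mpr key

end Kernels

/-! ### Reproducing kernel Hilbert spaces, their duals and evaluation maps -/

section Dual

variable {H : Type*} [NormedAddCommGroup H] [InnerProductSpace ℂ H] [CompleteSpace H]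

/-- The inner product of the dual `H*`, linear in the first and antilinear in the second argument:
if `l` and `m` are represented by `g` and `h`, so that `l f = ⟪g, f⟫` and `m f = ⟪h, f⟫`, its value
is `⟪g, h⟫` (Mathlib's inner product is antilinear in its first argument). -/
def dualInner (l m : StrongDual ℂ H) : ℂ :=
  ⟪(InnerProductSpace.toDual ℂ H).symm l, (InnerProductSpace.toDual ℂ H).symm m⟫_ℂ

/-- The Fubini-Study (degenerate) Hermitian metric on `H* \ {0}`. -/
def fubiniStudy (g f h : StrongDual ℂ H) : ℂ :=
  (1 / (‖g‖ : ℂ) ^ 2) * dualInner f h - (1 / (‖g‖ : ℂ) ^ 4) * (dualInner f g * dualInner g h)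

/-- The pseudodistance `δ₁` on `H* \ {0}`. -/
def delta₁ (g h : StrongDual ℂ H) : ℝ :=
  √(1 - ‖dualInner g h‖ ^ 2 / (‖g‖ ^ 2 * ‖h‖ ^ 2))

/-- The pseudodistance `δ₂` on `H* \ {0}`. -/
def delta₂ (g h : StrongDual ℂ H) : ℝ :=
  √(2 - 2 * (‖dualInner g h‖ / (‖g‖ * ‖h‖)))

end Dual

section EvalMap

variable {X : Type*} (F : Type*) [NormedAddCommGroup F] [InnerProductSpace ℂ F] [RKHS ℂ F X ℂ]

/-- The evaluation map `κ : X → F*` of a reproducing kernel Hilbert space, `κ(x) f = f(x)`. -/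
def evalMap (x : X) : StrongDual ℂ F :=
  (ContinuousLinearMap.proj x).comp (RKHS.coeCLM ℂ : F →L[ℂ] X → ℂ)

end EvalMap

/-! ### Domains in `ℂⁿ` -/

section Domain

variable {n : ℕ} {X : Set (EuclideanSpace ℂ (Fin n))}

/-- Extension by zero of a function on `X` to `ℂⁿ`. Only its germs at points of the open set `X`
are ever used. -/
def extendZero {V : Type*} [Zero V] (f : X → V) : EuclideanSpace ℂ (Fin n) → V :=
  Function.extend Subtype.val f 0

/-- A function on an open set `X` is holomorphic. -/
def IsHolomorphic (f : X → ℂ) : Prop :=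
  DifferentiableOn ℂ (extendZero f) X

/-- Sesqui-holomorphic functions: holomorphic in the first variable, antiholomorphic (that is, with
holomorphic complex conjugate) in the second. -/
def IsSesquiHolomorphic (L : X → X → ℂ) : Prop :=
  (∀ y, IsHolomorphic fun x => L x y) ∧ ∀ x, IsHolomorphic fun y => conj (L x y)

/-- The derivative `uκ = ∑ u_j ∂κ/∂z_j (x)` of the evaluation map `κ : X → F*` at `x` along the
tangent vector `u = ∑ u_j ∂/∂z_j`. -/
def derivEval (F : Type*) [NormedAddCommGroup F] [InnerProductSpace ℂ F] [RKHS ℂ F X ℂ]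
    (x : X) (u : EuclideanSpace ℂ (Fin n)) : StrongDual ℂ F :=
  fderiv ℂ (extendZero (evalMap F : X → StrongDual ℂ F)) x u

/-- The metric `σ̃^K` on `X`: the pull-back of the Fubini-Study metric on `F* \ {0}` through the
evaluation map of the reproducing kernel Hilbert space `F` with kernel `K`. The tangent space at
each point is identified with `ℂⁿ`. -/
def fubiniStudyPullback (K : X → X → ℂ) (hK : IsPosSemidefKernel K) (x : X)
    (u v : EuclideanSpace ℂ (Fin n)) : ℂ :=
  haveI : Fact (opKernel K).PosSemidef := ⟨hK.opKernel_posSemidef⟩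
  fubiniStudy (evalMap (RKHS.OfKernel (opKernel K)) x)
    (derivEval (RKHS.OfKernel (opKernel K)) x u) (derivEval (RKHS.OfKernel (opKernel K)) x v)

/-- `δ₁^K`: the pull-back of `δ₁` through the evaluation map of the reproducing kernel Hilbert
space with kernel `K`. -/
def delta₁Pullback (K : X → X → ℂ) (hK : IsPosSemidefKernel K) (x y : X) : ℝ :=
  haveI : Fact (opKernel K).PosSemidef := ⟨hK.opKernel_posSemidef⟩
  delta₁ (evalMap (RKHS.OfKernel (opKernel K)) x) (evalMap (RKHS.OfKernel (opKernel K)) y)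

/-- `δ₂^K`: the pull-back of `δ₂` through the evaluation map of the reproducing kernel Hilbert
space with kernel `K`. -/
def delta₂Pullback (K : X → X → ℂ) (hK : IsPosSemidefKernel K) (x y : X) : ℝ :=
  haveI : Fact (opKernel K).PosSemidef := ⟨hK.opKernel_posSemidef⟩
  delta₂ (evalMap (RKHS.OfKernel (opKernel K)) x) (evalMap (RKHS.OfKernel (opKernel K)) y)

end Domain

end KernelMetric

end

open scoped ComplexOrder ComplexConjugate InnerProductSpace
open Metric Set Filter Topology

/-! Everything is read off the Gram kernels `K(x, y) = ⟨α x, α y⟩` and `L(x, y) = ⟨β x, β y⟩` of the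
two evaluation maps. Fix a point `p` and consider the sesqui-holomorphic function `rescalingDefect`,
`D(x, y) = L(x, p) L(p, y) K(x, y) K(p, p) - K(x, p) K(p, y) L(x, y) L(p, p)`. If `D` vanishes on
the diagonal near `p`, polarization makes it vanish near `(p, p)`, and the identity theorem on all
of `X × X` (`rescalingDefect_eq_zero`). Then a multiple of `K(·, p) / L(·, p)` is a rescaling factor
on the dense open set where `K(·, p) ≠ 0`, and it continues across the remaining points because
neither kernel vanishes on the diagonal (`exists_rescaling`).

So the metric and the distances need only yield `D(x, x) = 0` near `p`. Both distances amount to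
`|K(x, y)|² / (K(x, x) K(y, y))`, and equality of these ratios at `(x, p)` is exactly `D(x, x) = 0`.
On a complex line through `p` the metric is the mixed derivative of `log K`; once polarized, it
determines `log K` up to a function of each variable separately, and this again gives `D(x, x) = 0`.
Conversely, a rescaling factor cancels from the ratio and, being holomorphic, from the metric.

The analytic cost lies in showing that the evaluation map is holomorphic in norm when the kernel is
only separately holomorphic. Holomorphy tested on the span of the kernel sections suffices once the
map is locally bounded (`differentiableAt_of_bounded`), and local boundedness is a form of Hartogs'
theorem, obtained from Baire's theorem and subharmonicity (`exists_bound_diag`,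
`exists_bound_of_gram`). -/

namespace KernelMetric

/-! ### Cauchy estimates, the identity theorem and polarization. -/

section Analysis

variable {E : Type*} [NormedAddCommGroup E] [NormedSpace ℂ E]

/-- The first derivative of a bounded holomorphic function on a ball is bounded. -/
theorem norm_fderiv_le_of_bounded {f : E → ℂ} {c : E} {r M : ℝ} (hr : 0 < r)
    (hf : DifferentiableOn ℂ f (ball c r)) (hM : ∀ z ∈ ball c r, ‖f z‖ ≤ M) :
    ‖fderiv ℂ f c‖ ≤ 2 * M / r := by
  refine Complex.norm_fderiv_le_div_of_mapsTo_ball hf (fun z hz => ?_) hr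
  rw [mem_closedBall, dist_eq_norm]
  linarith [norm_sub_le (f z) (f c), hM z hz, hM c (mem_ball_self hr)]

/-- Quadratic remainder estimate for bounded holomorphic functions on a ball. -/
theorem norm_sub_sub_fderiv_le {f : E → ℂ} {c z : E} {r M : ℝ}
    (hf : DifferentiableOn ℂ f (ball c r)) (hM : ∀ z ∈ ball c r, ‖f z‖ ≤ M)
    (hz : z ∈ ball c r) :
    ‖f z - f c - fderiv ℂ f c (z - c)‖ ≤ 4 * M * (dist z c / r) ^ 2 := by
  have hr : 0 < r := nonempty_ball.mp ⟨z, hz⟩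
  have hc := hM c (mem_ball_self hr)
  have hM0 : 0 ≤ M := (norm_nonneg _).trans hc
  have hd : HasFDerivAt f (fderiv ℂ f c) c :=
    ((hf c (mem_ball_self hr)).differentiableAt (ball_mem_nhds c hr)).hasFDerivAt
  have hB := norm_fderiv_le_of_bounded hr hf hM
  -- Without its linear part, `f - f c` vanishes to second order at `c`, so the higher order Schwarz
  -- lemma applies; the increment of `f` and the linear part contribute `2 * M` each to the bound.
  let g : E → ℂ := fun z => f z - fderiv ℂ f c (z - c)
  have hg : DifferentiableOn ℂ g (ball c r) :=
    hf.sub ((fderiv ℂ f c).differentiable.comp (differentiable_id.sub_const c)).differentiableOn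
  have hgc : g c = f c := by simp [g]
  have hmaps : MapsTo g (ball c r) (closedBall (g c) (4 * M)) := by
    intro w hw
    rw [mem_closedBall, dist_eq_norm, hgc]
    have h1 : ‖fderiv ℂ f c (w - c)‖ ≤ 2 * M := by
      refine ((fderiv ℂ f c).le_opNorm _).trans ?_
      have : ‖w - c‖ ≤ r := by rw [← dist_eq_norm]; exact (mem_ball.mp hw).le
      calc _ ≤ 2 * M / r * r := by gcongr
        _ = 2 * M := by field_simp
    have h2 := norm_sub_le (f w - f c) (fderiv ℂ f c (w - c))
    have h3 := norm_sub_le (f w) (f c)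
    have h4 := hM w hw
    have : g w - f c = f w - f c - fderiv ℂ f c (w - c) := by simp only [g]; ring
    rw [this]
    linarith
  have hlo : (g · - g c) =o[𝓝 c] (fun w => ‖w - c‖ ^ 1) := by
    have := hd.isLittleO
    simp only [pow_one]
    refine (this.norm_right).congr_left fun w => ?_
    simp only [g, hgc]; ring
  have := Complex.dist_le_mul_div_pow_of_mapsTo_ball_of_isLittleO hg hmaps hlo hz
  rw [dist_eq_norm, hgc] at this
  have h : g z - f c = f z - f c - fderiv ℂ f c (z - c) := by simp only [g]; ring
  rwa [h] at this

theorem differentiableAt_comp_line {F : Type*} [NormedAddCommGroup F] [NormedSpace ℂ F]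
    {f : E → F} {p u : E} {t : ℂ} (hf : DifferentiableAt ℂ f (p + t • u)) :
    DifferentiableAt ℂ (fun s : ℂ => f (p + s • u)) t :=
  DifferentiableAt.comp (g := f) (f := fun s : ℂ => p + s • u) t hf
    ((differentiableAt_const p).add (differentiableAt_id.smul_const u))

/-- Identity theorem for holomorphic functions of several variables. -/
theorem eqOn_zero_of_eventually_zero {f : E → ℂ} {X : Set E} (hX : IsOpen X)
    (hc : IsPreconnected X) (hf : DifferentiableOn ℂ f X) {p : E} (hp : p ∈ X)
    (h0 : ∀ᶠ z in 𝓝 p, f z = 0) : ∀ z ∈ X, f z = 0 := by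
  have hsub : X ⊆ {q | ∀ᶠ z in 𝓝 q, f z = 0} := by
    refine hc.subset_of_closure_inter_subset (isOpen_setOfPred_eventually_nhds) ⟨p, hp, h0⟩ ?_
    rintro q ⟨hq, hqX⟩
    obtain ⟨r, hr, hball⟩ := Metric.isOpen_iff.mp hX q hqX
    obtain ⟨a, ha, haq⟩ := Metric.mem_closure_iff.mp hq r hr
    have haq' : a ∈ ball q r := by rwa [mem_ball, dist_comm]
    change ∀ᶠ z in 𝓝 q, f z = 0
    filter_upwards [ball_mem_nhds q hr] with z hz
    -- The complex line through `a` and `z` meets the ball in a convex set of parameters containing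
    -- `0` and `1`, which reduces the claim to one variable.
    let ℓ : ℂ → E := fun t => a + t • (z - a)
    have hℓ : Continuous ℓ := by fun_prop
    let S : Set ℂ := ℓ ⁻¹' ball q r
    have hS : IsOpen S := isOpen_ball.preimage hℓ
    have hSc : IsPreconnected S := by
      refine Convex.isPreconnected ?_
      intro s hs t ht α β hα hβ hαβ
      have := convex_ball q r hs ht hα hβ hαβ
      refine mem_preimage.mpr ?_
      convert this using 1
      simp only [ℓ, smul_add, add_smul]
      have : a = α • a + β • a := by rw [← add_smul, hαβ, one_smul]
      nth_rewrite 1 [this]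
      simp only [smul_assoc]
      abel
    have han : AnalyticOnNhd ℂ (fun t => f (ℓ t)) S := by
      refine DifferentiableOn.analyticOnNhd (fun t ht => ?_) hS
      refine (differentiableAt_comp_line ?_).differentiableWithinAt
      exact (hf _ (hball ht)).differentiableAt (hX.mem_nhds (hball ht))
    have h0S : (0 : ℂ) ∈ S := by simpa [S, ℓ] using haq'
    have h1S : (1 : ℂ) ∈ S := by simpa [S, ℓ] using hz
    have hev : (fun t => f (ℓ t)) =ᶠ[𝓝 0] 0 := by
      have : Tendsto ℓ (𝓝 0) (𝓝 a) := by
        have := hℓ.tendsto 0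
        simpa [ℓ] using this
      exact this.eventually ha
    have := han.eqOn_zero_of_preconnected_of_eventuallyEq_zero hSc h0S hev h1S
    simpa [ℓ] using this
  exact fun z hz => (hsub hz).self_of_nhds

/-- The set where a holomorphic function on a domain does not vanish is dense. -/
theorem exists_ne_zero_of_eventually {f : E → ℂ} {X : Set E} (hX : IsOpen X)
    (hc : IsPreconnected X) (hf : DifferentiableOn ℂ f X) {p q : E} (hp : p ∈ X)
    (hfp : f p ≠ 0) (hq : q ∈ X) {P : E → Prop} (hP : ∀ᶠ z in 𝓝 q, P z) :
    ∃ z ∈ X, f z ≠ 0 ∧ P z := by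
  by_contra! h
  refine hfp (eqOn_zero_of_eventually_zero hX hc hf hq ?_ p hp)
  filter_upwards [hP, hX.mem_nhds hq] with z hz hzX
  by_contra hne
  exact h z hzX hne hz

/-- Polarization: a function of two variables, holomorphic along `(m + λ d, m + conj λ d)`, which
vanishes on the diagonal vanishes nearby. -/
theorem eq_zero_of_diag_eq_zero {Φ : E → E → ℂ} {p : E} {r : ℝ}
    (hd : ∀ m d : E, ∀ t : ℂ, m + t • d ∈ ball p r → m + conj t • d ∈ ball p r →
      DifferentiableAt ℂ (fun s : ℂ => Φ (m + s • d) (m + conj s • d)) t)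
    (h0 : ∀ x ∈ ball p r, Φ x x = 0) {x y : E} (hx : x ∈ ball p (r / 4))
    (hy : y ∈ ball p (r / 4)) : Φ x y = 0 := by
  have hr : 0 < r / 4 := nonempty_ball.mp ⟨x, hx⟩
  -- These are chosen so that `m + I • d = x` and `m - I • d = y`. Real parameters land on the
  -- diagonal, so the one-variable function vanishes at `1 / (n + 1)`, hence at `I`.
  let m : E := (1 / 2 : ℂ) • (x + y)
  let d : E := (-Complex.I / 2) • (x - y)
  have hmem : ∀ t ∈ ball (0 : ℂ) 2, m + t • d ∈ ball p r := by
    intro t ht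
    rw [mem_ball_zero_iff] at ht
    rw [mem_ball, dist_eq_norm] at hx hy ⊢
    have e : m + t • d - p = (1 / 2 : ℂ) • ((x - p) + (y - p)) +
        (t * (-Complex.I / 2)) • ((x - p) - (y - p)) := by
      simp only [m, d, smul_smul]
      module
    rw [e]
    have h1 : ‖(1 / 2 : ℂ) • ((x - p) + (y - p))‖ < r / 4 := by
      rw [norm_smul]
      have := norm_add_le (x - p) (y - p)
      norm_num
      linarith
    have h2 : ‖(t * (-Complex.I / 2)) • ((x - p) - (y - p))‖ ≤ 1 * (r / 2) := by
      rw [norm_smul]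
      have := norm_sub_le (x - p) (y - p)
      gcongr
      · simp only [norm_mul, norm_div, norm_neg, Complex.norm_I]
        norm_num
        linarith
      · linarith
    linarith [norm_add_le ((1 / 2 : ℂ) • ((x - p) + (y - p)))
      ((t * (-Complex.I / 2)) • ((x - p) - (y - p)))]
  have han : AnalyticOnNhd ℂ (fun s : ℂ => Φ (m + s • d) (m + conj s • d)) (ball 0 2) := by
    refine DifferentiableOn.analyticOnNhd (fun t ht => ?_) isOpen_ball
    refine (hd m d t (hmem t ht) (hmem _ ?_)).differentiableWithinAt
    simpa using ht
  have hfr : ∃ᶠ z in 𝓝[≠] (0 : ℂ), Φ (m + z • d) (m + conj z • d) = 0 := by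
    have ht : Tendsto (fun n : ℕ => ((1 / ((n : ℝ) + 1) : ℝ) : ℂ)) atTop (𝓝[≠] 0) := by
      refine tendsto_nhdsWithin_iff.mpr ⟨?_, Eventually.of_forall fun n => ?_⟩
      · have := (Complex.continuous_ofReal.tendsto 0).comp
          (tendsto_one_div_add_atTop_nhds_zero_nat (𝕜 := ℝ))
        simpa [Function.comp_def] using this
      · simp only [mem_compl_iff, mem_singleton_iff, Complex.ofReal_eq_zero]
        positivity
    refine ht.frequently (Eventually.frequently ?_)
    have : ∀ᶠ n : ℕ in atTop, ((1 / ((n : ℝ) + 1) : ℝ) : ℂ) ∈ ball (0 : ℂ) 2 :=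
      (tendsto_nhdsWithin_iff.mp ht).1.eventually (ball_mem_nhds 0 two_pos)
    filter_upwards [this] with n hn
    rw [Complex.conj_ofReal]
    exact h0 _ (hmem _ hn)
  have := han.eqOn_zero_of_preconnected_of_frequently_eq_zero
    (convex_ball (0 : ℂ) 2).isPreconnected (mem_ball_self two_pos) hfr
    (show Complex.I ∈ ball (0 : ℂ) 2 by simp)
  have e1 : m + Complex.I • d = x := by
    have : Complex.I * (-Complex.I / 2) = 1 / 2 := by
      linear_combination (-1 / 2 : ℂ) * Complex.I_mul_I
    simp only [m, d, smul_smul, this]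
    module
  have e2 : m + conj Complex.I • d = y := by
    have : -Complex.I * (-Complex.I / 2) = -1 / 2 := by
      linear_combination (1 / 2 : ℂ) * Complex.I_mul_I
    simp only [m, d, smul_smul, Complex.conj_I, this]
    module
  simpa only [e1, e2, Pi.zero_apply] using this

end Analysis

/-! ### Subharmonicity of `log⁺ ‖f‖` and Hartogs' lemma. -/

section Submean

open MeasureTheory Real

/-- `log⁺ ‖f‖` has the sub-mean value property on circles. -/
theorem posLog_norm_le_circleAverage {f : ℂ → ℂ} {c : ℂ} {r : ℝ} (hr : 0 < r)
    (hf : AnalyticOnNhd ℂ f (closedBall c r)) :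
    log⁺ ‖f c‖ ≤ circleAverage (fun z => log⁺ ‖f z‖) c r := by
  have hr' : |r| = r := abs_of_pos hr
  have hmer : MeromorphicOn f (sphere c |r|) := by
    rw [hr']
    exact fun z hz => (hf z (sphere_subset_closedBall hz)).meromorphicAt
  by_cases h1 : ‖f c‖ ≤ 1
  · rw [(posLog_eq_zero_iff _).mpr (by simpa using h1)]
    exact circleAverage_nonneg_of_nonneg fun _ _ => posLog_nonneg
  · push Not at h1
    have hne : f c ≠ 0 := by
      intro h
      simp [h] at h1
      linarith
    -- Jensen's formula: the average exceeds `log ‖f c‖` by a sum over the zeros in the disc, whose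
    -- terms are nonnegative.
    have hJ := AnalyticOnNhd.circleAverage_log_norm hr.ne' (hr'.symm ▸ hf) hne
    have hsum : 0 ≤ ∑ᶠ u, (MeromorphicOn.divisor f (closedBall c |r|) u : ℝ)
        * log (r * ‖c - u‖⁻¹) := by
      refine finsum_nonneg fun u => ?_
      by_cases hu : u ∈ closedBall c |r|
      · refine mul_nonneg ?_ ?_
        · exact_mod_cast MeromorphicOn.AnalyticOnNhd.divisor_nonneg (hr'.symm ▸ hf) u
        -- At `u = c` the factor is `log (r * 0⁻¹) = log 0 = 0`.
        · rcases eq_or_ne c u with rfl | hcu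
          · simp
          · refine log_nonneg ?_
            have hpos : 0 < ‖c - u‖ := norm_pos_iff.mpr (sub_ne_zero.mpr hcu)
            rw [hr', mem_closedBall, dist_comm, dist_eq_norm] at hu
            rw [← div_eq_mul_inv, le_div_iff₀ hpos]
            linarith
      · rw [Function.locallyFinsuppWithin.apply_eq_zero_of_notMem _ hu]
        simp
    calc log⁺ ‖f c‖ = log ‖f c‖ := posLog_eq_log (by simpa using h1.le)
      _ ≤ circleAverage (fun z => log ‖f z‖) c r := by rw [hJ]; linarith
      _ ≤ _ := by
        refine circleAverage_mono hmer.circleIntegrable_log_norm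
          hmer.circleIntegrable_posLog_norm fun z _ => ?_
        exact le_max_right _ _

/-- Sub-mean value inequalities on circles give one on discs. -/
theorem ofReal_mul_le_lintegral_ball {ψ : ℂ → ℝ} {c : ℂ} {ρ : ℝ} (hρ : 0 < ρ)
    (hψ : ContinuousOn ψ (ball c ρ)) (h0 : ∀ z, 0 ≤ ψ z)
    (hsub : ∀ r ∈ Ioo 0 ρ, ψ c ≤ circleAverage ψ c r) :
    ENNReal.ofReal (π * ρ ^ 2 * ψ c) ≤ ∫⁻ z in ball c ρ, ENNReal.ofReal (ψ z) := by
  let g : ℂ → ENNReal := (ball c ρ).indicator fun z => ENNReal.ofReal (ψ z)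
  have hg : Measurable g := by
    classical
    have : g = (ball c ρ).piecewise (fun z => ENNReal.ofReal (ψ z)) 0 := by
      rw [Set.piecewise_eq_indicator]
    rw [this]
    exact ContinuousOn.measurable_piecewise (ENNReal.continuous_ofReal.comp_continuousOn hψ)
      continuousOn_const measurableSet_ball
  -- The lower integral spares any integrability of `ψ` up to the boundary circle; in polar
  -- coordinates each circle contributes at least `2 * π * r * ψ c`.
  have hpol : ∫⁻ z in ball c ρ, ENNReal.ofReal (ψ z) =
      ∫⁻ r in Ioi (0 : ℝ), ∫⁻ θ in Ioo (-π) π,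
        ENNReal.ofReal r * g (Complex.polarCoord.symm (r, θ) + c) := by
    rw [← lintegral_indicator measurableSet_ball]
    change ∫⁻ z, g z = _
    rw [← lintegral_add_right_eq_self g c,
      ← Complex.lintegral_comp_polarCoord_symm (fun z => g (z + c)), polarCoord_target,
      Measure.volume_eq_prod, ← Measure.prod_restrict, lintegral_prod]
    · rfl
    · refine Measurable.aemeasurable ?_
      have hm : Measurable fun p : ℝ × ℝ => Complex.polarCoord.symm p := by
        simp only [Complex.polarCoord_symm_apply]
        fun_prop
      exact (ENNReal.measurable_ofReal.comp measurable_fst).smul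
        (hg.comp (hm.add_const c))
  have hinner : ∀ r ∈ Ioo 0 ρ, ENNReal.ofReal (r * (2 * π * ψ c)) ≤ ∫⁻ θ in Ioo (-π) π,
        ENNReal.ofReal r * g (Complex.polarCoord.symm (r, θ) + c) := by
    intro r hr
    have hmem : ∀ θ, circleMap c r θ ∈ ball c ρ := fun θ =>
      (sphere_subset_closedBall.trans (closedBall_subset_ball hr.2)) (circleMap_mem_sphere c hr.1.le θ)
    have hgθ : ∀ θ, g (Complex.polarCoord.symm (r, θ) + c) =
        ENNReal.ofReal (ψ (circleMap c r θ)) := by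
      intro θ
      have : Complex.polarCoord.symm (r, θ) + c = circleMap c r θ := by
        simp [circleMap, Complex.exp_mul_I, add_comm]
      rw [this]
      exact Set.indicator_of_mem (hmem θ) _
    have hcont : Continuous fun θ => ψ (circleMap c r θ) :=
      hψ.comp_continuous (continuous_circleMap c r) hmem
    have hmeas : Measurable fun θ => ENNReal.ofReal (ψ (circleMap c r θ)) :=
      ENNReal.measurable_ofReal.comp hcont.measurable
    simp_rw [hgθ]
    rw [lintegral_const_mul _ hmeas,
      ← ofReal_integral_eq_lintegral_ofReal
        ((hcont.integrableOn_Icc (a := -π) (b := π)).mono_set Ioo_subset_Icc_self)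
        (ae_of_all _ fun θ => h0 _), ← ENNReal.ofReal_mul hr.1.le]
    refine ENNReal.ofReal_le_ofReal ?_
    have hav := hsub r hr
    rw [circleAverage_eq_integral_add (-π), intervalIntegral.integral_comp_add_right
      (fun θ => ψ (circleMap c r θ)), smul_eq_mul] at hav
    have e : 0 + -π = -π := by ring
    have e' : 2 * π + -π = π := by ring
    rw [e, e', intervalIntegral.integral_of_le (by linarith [pi_pos]),
      integral_Ioc_eq_integral_Ioo] at hav
    gcongr
    · exact hr.1.le
    calc 2 * π * ψ c ≤ 2 * π * ((2 * π)⁻¹ * _) := by gcongr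
      _ = _ := by field_simp
  rw [hpol]
  calc ENNReal.ofReal (π * ρ ^ 2 * ψ c)
      = ∫⁻ r in Ioo 0 ρ, ENNReal.ofReal (r * (2 * π * ψ c)) := by
        rw [← ofReal_integral_eq_lintegral_ofReal]
        · rw [← integral_Ioc_eq_integral_Ioo, ← intervalIntegral.integral_of_le hρ.le,
            intervalIntegral.integral_mul_const, integral_id]
          congr 1
          ring
        · exact ((continuous_id.mul continuous_const).integrableOn_Icc).mono_set
            Ioo_subset_Icc_self
        · refine (ae_restrict_iff' measurableSet_Ioo).mpr (ae_of_all _ fun r hr => ?_)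
          exact mul_nonneg hr.1.le (mul_nonneg (by positivity) (h0 c))
    _ ≤ ∫⁻ r in Ioo 0 ρ, ∫⁻ θ in Ioo (-π) π,
        ENNReal.ofReal r * g (Complex.polarCoord.symm (r, θ) + c) :=
        setLIntegral_mono' measurableSet_Ioo hinner
    _ ≤ _ := lintegral_mono_set Ioo_subset_Ioi_self

/-- Hartogs' lemma: exponential growth bounds which hold pointwise hold locally uniformly, with an
arbitrarily small loss, as soon as there is some uniform exponential bound. -/
theorem exists_locally_uniform_bound {h : ℕ → ℂ → ℂ} {c : ℂ} {R ρ ρ' A B : ℝ} (hR : 0 < R)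
    (hh : ∀ n, DifferentiableOn ℂ (h n) (ball c R)) (hρ' : 0 < ρ') (hρ : ρ' < ρ)
    (hA : ∀ n, ∀ y ∈ ball c R, ‖h n y‖ ≤ A * B ^ n)
    (hpt : ∀ y ∈ ball c R, ∃ C, ∀ n, ‖h n y‖ * ρ ^ n ≤ C) :
    ∃ δ > 0, ∃ C, ∀ n, ∀ y ∈ ball c δ, ‖h n y‖ * ρ' ^ n ≤ C := by
  have hρ0 : 0 < ρ := hρ'.trans hρ
  let f : ℕ → ℂ → ℂ := fun n y => h n y * (ρ : ℂ) ^ n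
  have hfnorm : ∀ n y, ‖f n y‖ = ‖h n y‖ * ρ ^ n := fun n y => by
    simp [f, abs_of_pos hρ0]
  have hf : ∀ n, DifferentiableOn ℂ (f n) (ball c R) := fun n => (hh n).mul_const _
  -- The normalized logarithms turn exponential growth into size. Since `0⁻¹ = 0`, the term `n = 0`
  -- is zero and has to be treated apart.
  let ψ : ℕ → ℂ → ℝ := fun n y => (n : ℝ)⁻¹ • log⁺ ‖f n y‖
  have hψ0 : ∀ n y, 0 ≤ ψ n y := fun n y => smul_nonneg (by positivity) posLog_nonneg
  have hψc : ∀ n, ContinuousOn (ψ n) (ball c R) := fun n =>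
    (continuous_posLog.comp_continuousOn (hf n).continuousOn.norm).const_smul (n : ℝ)⁻¹
  have hle : ∀ (n : ℕ) (y : ℂ) (D : ℝ), log⁺ ‖f n y‖ ≤ n * D → 0 ≤ D → ψ n y ≤ D := by
    intro n y D hD hD0
    rcases Nat.eq_zero_or_pos n with rfl | hn
    · simpa [ψ] using hD0
    · have : (0 : ℝ) < n := by exact_mod_cast hn
      simp only [ψ, smul_eq_mul]
      rwa [inv_mul_le_iff₀ this]
  let D : ℝ := log⁺ A + log⁺ (B * ρ)
  have hD0 : 0 ≤ D := add_nonneg posLog_nonneg posLog_nonneg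
  have hψD : ∀ n, ∀ y ∈ ball c R, ψ n y ≤ D := by
    intro n y hy
    rcases Nat.eq_zero_or_pos n with rfl | hn
    · simpa [ψ] using hD0
    have hn1 : (1 : ℝ) ≤ n := by exact_mod_cast hn
    refine hle n y D ?_ hD0
    calc log⁺ ‖f n y‖ ≤ log⁺ (A * (B * ρ) ^ n) := by
          refine posLog_le_posLog (norm_nonneg _) ?_
          rw [hfnorm, mul_pow, ← mul_assoc]
          gcongr
          exact hA n y hy
      _ ≤ log⁺ A + log⁺ ((B * ρ) ^ n) := posLog_mul
      _ = log⁺ A + n * log⁺ (B * ρ) := by rw [posLog_pow]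
      _ ≤ n * log⁺ A + n * log⁺ (B * ρ) := by
          gcongr
          exact le_mul_of_one_le_left posLog_nonneg hn1
      _ = n * D := by ring
  have hlim : ∀ y ∈ ball c R, Tendsto (fun n => ψ n y) atTop (𝓝 0) := by
    intro y hy
    obtain ⟨C, hC⟩ := hpt y hy
    have h1 : Tendsto (fun n : ℕ => (n : ℝ)⁻¹ * log⁺ C) atTop (𝓝 0) := by
      simpa using (tendsto_inv_atTop_nhds_zero_nat (𝕜 := ℝ)).mul_const (log⁺ C)
    refine squeeze_zero (fun n => hψ0 n y) (fun n => ?_) h1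
    have hb : ‖f n y‖ ≤ C := (hfnorm n y).trans_le (hC n)
    have hl := posLog_le_posLog (norm_nonneg _) hb
    exact mul_le_mul_of_nonneg_left hl (by positivity)
  -- Pointwise convergence with a uniform bound gives convergence of the integrals, which the
  -- sub-mean value property converts back into a uniform pointwise bound.
  have hint : Tendsto (fun n => ∫⁻ y in ball c R, ENNReal.ofReal (ψ n y)) atTop (𝓝 0) := by
    have := tendsto_lintegral_of_dominated_convergence' (μ := volume.restrict (ball c R))
      (F := fun n y => ENNReal.ofReal (ψ n y)) (f := fun _ => 0) (fun _ => ENNReal.ofReal D)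
      (fun n => (ENNReal.measurable_ofReal.comp_aemeasurable
        ((hψc n).aemeasurable measurableSet_ball)))
      (fun n => (ae_restrict_iff' measurableSet_ball).mpr
        (ae_of_all _ fun y hy => ENNReal.ofReal_le_ofReal (hψD n y hy)))
      (by
        rw [lintegral_const]
        exact ENNReal.mul_ne_top ENNReal.ofReal_ne_top (by
          rw [Measure.restrict_apply_univ]
          exact measure_ball_lt_top.ne))
      ((ae_restrict_iff' measurableSet_ball).mpr (ae_of_all _ fun y hy => by
        simpa [Function.comp_def] using
          (ENNReal.continuous_ofReal.tendsto 0).comp (hlim y hy)))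
    simpa using this
  have hε : 0 < log (ρ / ρ') := log_pos ((one_lt_div hρ').mpr hρ)
  have hpos : 0 < ENNReal.ofReal (π * (R / 2) ^ 2 * log (ρ / ρ')) :=
    ENNReal.ofReal_pos.mpr (by positivity)
  obtain ⟨n₀, hn₀⟩ := eventually_atTop.mp
    ((hint.eventually (gt_mem_nhds hpos)).and (eventually_ge_atTop 1))
  -- For `y` within `R / 2` of `c`, the disc of radius `R / 2` about `y` stays in the big disc. The
  -- sum absorbs the finitely many `n < n₀` through the crude bound; the `1` serves the others.
  refine ⟨R / 2, by positivity, 1 + ∑ n ∈ Finset.range n₀, |A * B ^ n * ρ' ^ n|, ?_⟩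
  intro n y hy
  have hsum : 0 ≤ ∑ n ∈ Finset.range n₀, |A * B ^ n * ρ' ^ n| :=
    Finset.sum_nonneg fun _ _ => abs_nonneg _
  have hsubset : ball y (R / 2) ⊆ ball c R := ball_subset_ball' (by
    rw [mem_ball] at hy; linarith)
  have hyR : y ∈ ball c R := hsubset (mem_ball_self (by positivity))
  rcases lt_or_ge n n₀ with hn | hn
  · have h1 : ‖h n y‖ * ρ' ^ n ≤ |A * B ^ n * ρ' ^ n| := by
      refine le_trans ?_ (le_abs_self _)
      gcongr
      exact hA n y hyR
    have h2 := Finset.single_le_sum (f := fun n => |A * B ^ n * ρ' ^ n|)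
      (fun _ _ => abs_nonneg _) (Finset.mem_range.mpr hn)
    linarith
  · have hmean : ENNReal.ofReal (π * (R / 2) ^ 2 * ψ n y) ≤
        ∫⁻ z in ball y (R / 2), ENNReal.ofReal (ψ n z) := by
      refine ofReal_mul_le_lintegral_ball (by positivity) ((hψc n).mono hsubset) (hψ0 n) ?_
      intro r hr
      simp only [ψ]
      rw [circleAverage_fun_smul, smul_eq_mul, smul_eq_mul]
      gcongr
      refine posLog_norm_le_circleAverage hr.1 fun z hz => ?_
      exact (hf n).analyticOnNhd isOpen_ball z (hsubset (closedBall_subset_ball hr.2 hz))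
    have hlt := (hmean.trans (lintegral_mono_set hsubset)).trans_lt (hn₀ n hn).1
    rw [ENNReal.ofReal_lt_ofReal_iff (by positivity)] at hlt
    have hψlt : ψ n y < log (ρ / ρ') := lt_of_mul_lt_mul_left hlt (by positivity)
    have key : ‖f n y‖ ≤ (ρ / ρ') ^ n := by
      by_contra! hcon
      have h1 : 1 ≤ (ρ / ρ') ^ n := one_le_pow₀ ((one_le_div hρ').mpr hρ.le)
      have h2 : log ((ρ / ρ') ^ n) < log⁺ ‖f n y‖ := by
        rw [posLog_eq_log (by rw [abs_norm]; exact (h1.trans hcon.le))]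
        exact log_lt_log (by positivity) hcon
      rw [log_pow] at h2
      have hnp : (0 : ℝ) < n := by exact_mod_cast (hn₀ n hn).2
      have h3 : log (ρ / ρ') < ψ n y := by
        simp only [ψ, smul_eq_mul]
        rwa [lt_inv_mul_iff₀ hnp]
      linarith
    rw [hfnorm, div_pow, le_div_iff₀ (by positivity)] at key
    have hρn : 0 < ρ ^ n := by positivity
    have : ‖h n y‖ * ρ' ^ n ≤ 1 := by
      by_contra! hcon
      nlinarith
    linarith

end Submean

/-! ### Separately holomorphic Hermitian functions of two complex variables. -/

section Hartogs

/-- A Baire category argument: countably many closed sets covering a ball. -/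
theorem exists_ball_subset_of_cover {Y : Type*} [MetricSpace Y] [CompleteSpace Y] {c : Y} {r : ℝ}
    (hr : 0 < r) {S : ℕ → Set Y} (hcl : ∀ N, IsClosed (S N))
    (hcov : ∀ y ∈ ball c r, ∃ N, y ∈ S N) :
    ∃ N, ∃ b ∈ ball c r, ∃ ε > 0, ball b ε ⊆ S N := by
  -- Adding the complement of the ball gives a closed cover of the whole space; an interior point
  -- found inside the ball must come from `S N`.
  have hd := dense_iUnion_interior_of_closed (f := fun N => (ball c r)ᶜ ∪ S N)
    (fun N => isOpen_ball.isClosed_compl.union (hcl N)) (by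
      refine eq_univ_of_forall fun y => mem_iUnion.mpr ?_
      by_cases hy : y ∈ ball c r
      · exact (hcov y hy).imp fun N hN => Or.inr hN
      · exact ⟨0, Or.inl hy⟩)
  obtain ⟨b, hb, hbU⟩ := hd.inter_open_nonempty (ball c r) isOpen_ball ⟨c, mem_ball_self hr⟩
  obtain ⟨N, hN⟩ := mem_iUnion.mp hbU
  obtain ⟨ε, hε, hsub⟩ := Metric.mem_nhds_iff.mp
    (inter_mem (mem_interior_iff_mem_nhds.mp hN) (isOpen_ball.mem_nhds hb))
  exact ⟨N, b, hb, ε, hε, fun y hy => (hsub hy).1.resolve_left fun h => h (hsub hy).2⟩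

/-- The derivative in one variable of a bounded separately holomorphic function is holomorphic in
the other variable. -/
theorem differentiableOn_conj_deriv {V : Set ℂ} (hV : IsOpen V) {k : ℂ → ℂ → ℂ} {x : ℂ}
    {s N : ℝ} (hs : 0 < s) (h1 : ∀ y ∈ V, DifferentiableOn ℂ (fun x => k x y) (ball x s))
    (h2 : ∀ x' ∈ ball x s, DifferentiableOn ℂ (fun y => conj (k x' y)) V)
    (hN : ∀ x' ∈ ball x s, ∀ y ∈ V, ‖k x' y‖ ≤ N) :
    DifferentiableOn ℂ (fun y => conj (deriv (fun x => k x y) x)) V := by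
  -- Steps of difference quotients; the `+ 2` keeps even the first one below `s`. The quadratic
  -- remainder makes the quotients converge uniformly in `y`, and uniform limits preserve
  -- holomorphy.
  let t : ℕ → ℝ := fun j => s / (j + 2)
  have ht0 : ∀ j, 0 < t j := fun j => by positivity
  have hts : ∀ j, t j < s := fun j => by
    have : (0 : ℝ) ≤ j := j.cast_nonneg
    exact div_lt_self hs (by linarith)
  have hmem : ∀ j, x + (t j : ℂ) ∈ ball x s := fun j => by
    rw [mem_ball, dist_eq_norm, add_sub_cancel_left, Complex.norm_real, Real.norm_of_nonneg
      (ht0 j).le]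
    exact hts j
  have hbd : ∀ j, ∀ y ∈ V, ‖(k (x + t j) y - k x y) / t j - deriv (fun x => k x y) x‖ ≤
      4 * N / s ^ 2 * t j := by
    intro j y hy
    have := norm_sub_sub_fderiv_le (h1 y hy) (fun z hz => hN z hz y hy) (hmem j)
    rw [fderiv_eq_smul_deriv, add_sub_cancel_left, smul_eq_mul, dist_eq_norm,
      add_sub_cancel_left, Complex.norm_real, Real.norm_of_nonneg (ht0 j).le] at this
    have hne : (t j : ℂ) ≠ 0 := by exact_mod_cast (ht0 j).ne'
    have e : (k (x + t j) y - k x y) / t j - deriv (fun x => k x y) x =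
        (k (x + t j) y - k x y - t j * deriv (fun x => k x y) x) / t j := by
      field_simp
    rw [e, norm_div, Complex.norm_real, Real.norm_of_nonneg (ht0 j).le, div_le_iff₀ (ht0 j)]
    refine this.trans_eq ?_
    ring
  have hlim : Tendsto (fun j => 4 * N / s ^ 2 * t j) atTop (𝓝 0) := by
    have h3 : Tendsto t atTop (𝓝 0) := by
      have : Tendsto (fun j : ℕ => (j : ℝ) + 2) atTop atTop :=
        tendsto_atTop_add_const_right _ _ tendsto_natCast_atTop_atTop
      exact this.const_div_atTop s
    simpa using h3.const_mul (4 * N / s ^ 2)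
  have hunif : TendstoUniformlyOn (fun j y => conj ((k (x + t j) y - k x y) / t j))
      (fun y => conj (deriv (fun x => k x y) x)) atTop V := by
    rw [Metric.tendstoUniformlyOn_iff]
    intro ε hε
    filter_upwards [hlim.eventually (gt_mem_nhds hε)] with j hj y hy
    rw [dist_comm, dist_eq_norm, ← map_sub, RCLike.norm_conj]
    exact (hbd j y hy).trans_lt hj
  refine hunif.tendstoLocallyUniformlyOn.differentiableOn (Eventually.of_forall fun j => ?_) hV
  have h3 := ((h2 _ (hmem j)).sub (h2 x (mem_ball_self hs))).div_const (t j : ℂ)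
  refine h3.congr fun y _ => ?_
  simp

/-- Induction with `k`, `s` and `N` free: `k` is replaced by its derivative in the first variable on
the disc of half the radius, where Cauchy's estimate supplies the new bound. -/
theorem differentiableOn_conj_iteratedDeriv {V : Set ℂ} (hV : IsOpen V) {b : ℂ} (n : ℕ) :
    ∀ {k : ℂ → ℂ → ℂ} {s N : ℝ}, 0 < s →
    (∀ y ∈ V, DifferentiableOn ℂ (fun x => k x y) (ball b s)) →
    (∀ x ∈ ball b s, DifferentiableOn ℂ (fun y => conj (k x y)) V) →
    (∀ x ∈ ball b s, ∀ y ∈ V, ‖k x y‖ ≤ N) →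
    DifferentiableOn ℂ (fun y => conj (iteratedDeriv n (fun x => k x y) b)) V := by
  induction n with
  | zero =>
    intro k s N hs _ h2 _
    simpa using h2 b (mem_ball_self hs)
  | succ n ih =>
    intro k s N hs h1 h2 hN
    simp only [iteratedDeriv_succ']
    have hsub : ∀ x ∈ ball b (s / 2), ball x (s / 2) ⊆ ball b s := fun x hx =>
      ball_subset_ball' (by rw [mem_ball] at hx; linarith)
    refine ih (k := fun x y => deriv (fun x => k x y) x) (s := s / 2) (N := 2 * N / (s / 2))
      (by positivity) (fun y hy => ?_) (fun x hx => ?_) (fun x hx y hy => ?_)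
    · exact ((h1 y hy).deriv isOpen_ball).mono (ball_subset_ball (by linarith))
    · exact differentiableOn_conj_deriv hV (half_pos hs) (fun y hy => (h1 y hy).mono (hsub x hx))
        (fun x' hx' => h2 x' (hsub x hx hx')) (fun x' hx' => hN x' (hsub x hx hx'))
    · rw [norm_deriv_eq_norm_fderiv]
      exact norm_fderiv_le_of_bounded (half_pos hs) ((h1 y hy).mono (hsub x hx))
        fun z hz => hN z (hsub x hx hz) y hy

/-- Hartogs' theorem for Hermitian functions: separate holomorphy implies that the diagonal is
locally bounded. -/
theorem exists_bound_diag {k : ℂ → ℂ → ℂ} {c : ℂ} {R : ℝ} (hR : 0 < R)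
    (hhol : ∀ y ∈ ball c R, DifferentiableOn ℂ (fun x => k x y) (ball c R))
    (hsymm : ∀ x ∈ ball c R, ∀ y ∈ ball c R, k x y = conj (k y x)) :
    ∃ δ > 0, ∃ C, ∀ x ∈ ball c δ, ‖k x x‖ ≤ C := by
  have hK : closedBall c (3 * R / 4) ⊆ ball c R := closedBall_subset_ball (by linarith)
  have hK4 : closedBall c (R / 4) ⊆ ball c R := closedBall_subset_ball (by linarith)
  have hanti : ∀ x ∈ ball c R, DifferentiableOn ℂ (fun y => conj (k x y)) (ball c R) := by
    intro x hx
    refine (hhol x hx).congr fun y hy => ?_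
    rw [hsymm y hy x hx]
  -- For each `y`, the function `k(·, y)` is bounded on the compact disc; by Baire one bound serves
  -- all `y` in some small disc about a point `b`.
  obtain ⟨N, b, hb, ε, hε, hball⟩ := exists_ball_subset_of_cover (c := c) (r := R / 4)
    (by positivity)
    (S := fun N : ℕ => closedBall c (R / 4) ∩
      ⋂ x ∈ closedBall c (3 * R / 4), {y | y ∈ closedBall c (R / 4) ∧ ‖k x y‖ ≤ N})
    (fun N => by
      refine isClosed_closedBall.inter (isClosed_biInter fun x hx => ?_)
      have : ContinuousOn (fun y => ‖k x y‖) (closedBall c (R / 4)) := by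
        have := ((hanti x (hK hx)).continuousOn.norm).mono hK4
        simpa using this
      exact this.preimage_isClosed_of_isClosed isClosed_closedBall isClosed_Iic)
    (fun y hy => by
      have hy' := ball_subset_closedBall hy
      obtain ⟨C, hC⟩ := (isCompact_closedBall c (3 * R / 4)).exists_bound_of_continuousOn
        ((hhol y (hK4 hy')).continuousOn.mono hK)
      obtain ⟨N, hN⟩ := exists_nat_ge C
      exact ⟨N, hy', mem_iInter₂.mpr fun x hx => ⟨hy', (hC x hx).trans hN⟩⟩)
  have hbd : ∀ y ∈ ball b ε, ∀ x ∈ closedBall c (3 * R / 4), ‖k x y‖ ≤ N := fun y hy x hx =>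
    (mem_iInter₂.mp (hball hy).2 x hx).2
  have hbc : dist b c < R / 4 := hb
  have hVc : ball b (R / 2) ⊆ closedBall c (3 * R / 4) := fun y hy => by
    rw [mem_closedBall]
    rw [mem_ball] at hy
    linarith [dist_triangle y b c]
  have hV : ball b (R / 2) ⊆ ball c R := hVc.trans hK
  set s : ℝ := min ε (R / 2)
  have hs : 0 < s := lt_min hε (by positivity)
  have hsV : ball b s ⊆ ball b (R / 2) := ball_subset_ball (min_le_right _ _)
  -- Hermitian symmetry exchanges the roles: now `x` is confined to a small disc while `y` ranges
  -- over a large one that contains a neighbourhood of `c`.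
  have hbd' : ∀ x ∈ ball b s, ∀ y ∈ ball b (R / 2), ‖k x y‖ ≤ N := by
    intro x hx y hy
    rw [hsymm x (hV (hsV hx)) y (hV hy), RCLike.norm_conj]
    exact hbd x (ball_subset_ball (min_le_left _ _) hx) y (hVc hy)
  -- Taylor coefficients of `k(·, y)` at `b`, conjugated so as to be holomorphic in `y`.
  let h : ℕ → ℂ → ℂ := fun n y => conj (iteratedDeriv n (fun x => k x y) b) / (n.factorial : ℂ)
  have hcauchy : ∀ y ∈ ball b (R / 2), ∀ ρ, 0 < ρ → ρ < R / 2 → ∀ C,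
      (∀ z ∈ sphere b ρ, ‖k z y‖ ≤ C) → ∀ n, ‖h n y‖ ≤ C / ρ ^ n := by
    intro y hy ρ hρ hρR C hC n
    have hdiff : DiffContOnCl ℂ (fun x => k x y) (ball b ρ) :=
      DifferentiableOn.diffContOnCl_ball ((hhol y (hV hy)).mono hV) (closedBall_subset_ball hρR)
    have := Complex.norm_iteratedDeriv_le_of_forall_mem_sphere_norm_le n hρ hdiff hC
    simp only [h, norm_div, RCLike.norm_conj, Complex.norm_natCast]
    rw [div_le_iff₀ (by positivity)]
    refine this.trans_eq ?_
    ring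
  have hsub : ball c (R / 4) ⊆ ball b (R / 2) := ball_subset_ball' (by
    rw [dist_comm]; linarith)
  -- The radii satisfy `R / 4 < R / 3 < 2 * R / 5 < R / 2`: Cauchy's estimate at `2 * R / 5` holds
  -- for each `y`, the one at `R / 3` uniformly near `c`, and for `‖x - b‖ < R / 4` the Taylor
  -- series is dominated by a geometric one of ratio `3 / 4`.
  obtain ⟨δ, hδ, C, hC⟩ := exists_locally_uniform_bound (h := h) (c := c) (R := R / 4)
    (ρ := 2 * R / 5) (ρ' := R / 3) (A := N) (B := 2 / s) (by positivity)
    (fun n => by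
      refine DifferentiableOn.div_const (DifferentiableOn.mono ?_ hsub) _
      exact differentiableOn_conj_iteratedDeriv isOpen_ball n hs
        (fun y hy => (hhol y (hV hy)).mono (hsV.trans hV))
        (fun x hx => (hanti x (hV (hsV hx))).mono hV) hbd')
    (by positivity) (by linarith)
    (fun n y hy => by
      have h1 : s / 2 < R / 2 := by
        have := min_le_right ε (R / 2)
        linarith
      refine (hcauchy y (hsub hy) (s / 2) (by positivity) h1 N (fun z hz => ?_) n).trans_eq ?_
      · refine hbd' z ?_ y (hsub hy)
        rw [mem_sphere] at hz
        rw [mem_ball, hz]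
        linarith
      · rw [div_eq_mul_inv, ← inv_pow, inv_div])
    (fun y hy => by
      have hsph : sphere b (2 * R / 5) ⊆ ball b (R / 2) := fun z hz => by
        rw [mem_sphere] at hz
        rw [mem_ball, hz]
        linarith
      obtain ⟨C, hC⟩ := (isCompact_sphere b (2 * R / 5)).exists_bound_of_continuousOn
        ((hhol y (hV (hsub hy))).continuousOn.mono (hsph.trans hV))
      refine ⟨C, fun n => ?_⟩
      have := hcauchy y (hsub hy) (2 * R / 5) (by positivity) (by linarith) C hC n
      rwa [le_div_iff₀ (by positivity)] at this)
  refine ⟨min δ (R / 4 - dist b c), lt_min hδ (by linarith), C * (1 - 3 / 4)⁻¹, fun x hx => ?_⟩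
  have hx1 : x ∈ ball c δ := ball_subset_ball (min_le_left _ _) hx
  have hxc : dist x c < R / 4 - dist b c := lt_of_lt_of_le hx (min_le_right _ _)
  have hxb : ‖x - b‖ < R / 4 := by
    rw [← dist_eq_norm]
    linarith [dist_triangle x c b, dist_comm b c]
  have hxV : x ∈ ball b (R / 2) := by
    rw [mem_ball, dist_eq_norm]
    linarith
  have htay := Complex.hasSum_taylorSeries_on_ball ((hhol x (hV hxV)).mono hV) hxV
  have hgeo := (hasSum_geometric_of_lt_one (r := (3 / 4 : ℝ)) (by norm_num)
    (by norm_num)).mul_left C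
  rw [← htay.tsum_eq]
  refine tsum_of_norm_bounded hgeo fun n => ?_
  have h1 : ‖((n.factorial : ℂ))⁻¹ • (x - b) ^ n • iteratedDeriv n (fun z => k z x) b‖ =
      ‖h n x‖ * ‖x - b‖ ^ n := by
    simp only [h, norm_smul, norm_div, RCLike.norm_conj, norm_inv, norm_pow]
    ring
  rw [h1]
  calc ‖h n x‖ * ‖x - b‖ ^ n ≤ ‖h n x‖ * (R / 4) ^ n := by gcongr
    _ = ‖h n x‖ * (R / 3) ^ n * (3 / 4) ^ n := by
      rw [mul_assoc, ← mul_pow]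
      congr 2
      ring
    _ ≤ C * (3 / 4) ^ n := by
      gcongr
      exact hC n x hx1

end Hartogs

/-! ### From weak holomorphy to norm holomorphy of maps into a dual space. -/

section WeakHolomorphy

variable {E : Type*} [NormedAddCommGroup E] [NormedSpace ℂ E]

/-- The estimate is a closed condition on `f`. In the application `S` is the span of the kernel
sections, the only vectors on which holomorphy is known beforehand. -/
theorem opNorm_le_of_dense_submodule {F : Type*} [NormedAddCommGroup F] [NormedSpace ℂ F]
    {S : Submodule ℂ F} (hS : Dense (S : Set F)) {l : StrongDual ℂ F} {C : ℝ} (hC : 0 ≤ C)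
    (h : ∀ f ∈ S, ‖l f‖ ≤ C * ‖f‖) : ‖l‖ ≤ C := by
  refine l.opNorm_le_bound hC fun f => ?_
  have hcl : IsClosed {f : F | ‖l f‖ ≤ C * ‖f‖} :=
    isClosed_le (by fun_prop) (by fun_prop)
  exact hcl.closure_subset_iff.mpr h (hS f)

/-- A locally bounded map into a dual space which is holomorphic when tested on a dense subspace
is holomorphic. -/
theorem differentiableAt_of_bounded {F : Type*} [NormedAddCommGroup F] [NormedSpace ℂ F]
    {S : Submodule ℂ F} (hS : Dense (S : Set F)) {κ : E → StrongDual ℂ F} {c : E} {r M : ℝ}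
    (hr : 0 < r) (hM : ∀ x ∈ ball c r, ‖κ x‖ ≤ M)
    (hd : ∀ f ∈ S, DifferentiableOn ℂ (fun x => κ x f) (ball c r)) :
    DifferentiableAt ℂ κ c := by
  have hM0 : 0 ≤ M := (norm_nonneg _).trans (hM c (mem_ball_self hr))
  have hbd : ∀ f, ∀ x ∈ ball c r, ‖κ x f‖ ≤ M * ‖f‖ := fun f x hx =>
    (κ x).le_of_opNorm_le (hM x hx) f
  have hdc : ∀ f : S, DifferentiableAt ℂ (fun x => κ x f) c := fun f =>
    (hd f f.2 c (mem_ball_self hr)).differentiableAt (ball_mem_nhds c hr)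
  let B₀ : S →ₗ[ℂ] (E →L[ℂ] ℂ) :=
    { toFun := fun f => fderiv ℂ (fun x => κ x f) c
      map_add' := fun f g => by
        rw [← fderiv_fun_add (hdc f) (hdc g)]
        simp
      map_smul' := fun a f => by
        have := fderiv_const_smul (hdc f) a
        rw [RingHom.id_apply, ← this]
        congr 1
        ext x
        simp }
  -- Cauchy's estimate bounds the weak derivatives by a multiple of `‖f‖`, so they extend from `S`
  -- to `F`; flipping the extension gives the candidate derivative of `κ`.
  let B : S →L[ℂ] (E →L[ℂ] ℂ) := B₀.mkContinuous (2 * M / r) fun f => by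
    refine (norm_fderiv_le_of_bounded hr (hd f f.2) (hbd f)).trans_eq ?_
    rw [Submodule.coe_norm]
    ring
  let A : E →L[ℂ] StrongDual ℂ F := (B.extend S.subtypeL).flip
  have hA : ∀ (u : E) (f : S), A u f = fderiv ℂ (fun x => κ x f) c u := by
    intro u f
    have := B.extend_eq (e := S.subtypeL) (by
      rw [DenseRange, Submodule.coe_subtypeL, Submodule.coe_subtype, Subtype.range_coe]
      exact hS) isUniformEmbedding_subtype_val.isUniformInducing f
    simp only [A, ContinuousLinearMap.flip_apply]
    exact DFunLike.congr_fun this u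
  have hder : HasFDerivAt κ A c := by
    rw [hasFDerivAt_iff_isLittleO]
    refine Asymptotics.IsBigO.trans_isLittleO ?_ (Asymptotics.isLittleO_pow_sub_sub c one_lt_two)
    refine Asymptotics.IsBigO.of_bound (4 * M / r ^ 2) ?_
    filter_upwards [ball_mem_nhds c hr] with x hx
    refine opNorm_le_of_dense_submodule hS (by positivity) fun f hf => ?_
    have := norm_sub_sub_fderiv_le (hd f hf) (hbd f) hx
    have e : (κ x - κ c - A (x - c)) f = κ x f - κ c f - fderiv ℂ (fun x => κ x f) c (x - c) := by
      rw [sub_apply, sub_apply, ← hA _ ⟨f, hf⟩]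
    rw [e]
    refine this.trans_eq ?_
    rw [dist_eq_norm, norm_pow, norm_norm]
    ring
  exact hder.differentiableAt

variable {F : Type*} [NormedAddCommGroup F] [InnerProductSpace ℂ F] [CompleteSpace F]

theorem dualInner_eq_apply (l m : StrongDual ℂ F) :
    dualInner l m = l ((InnerProductSpace.toDual ℂ F).symm m) := by
  rw [dualInner, InnerProductSpace.toDual_symm_apply]

theorem dualInner_conj_symm (l m : StrongDual ℂ F) : conj (dualInner m l) = dualInner l m := by
  rw [dualInner, dualInner, inner_conj_symm]

theorem dualInner_self (l : StrongDual ℂ F) : dualInner l l = (‖l‖ : ℂ) ^ 2 := by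
  rw [dualInner, inner_self_eq_norm_sq_to_K, LinearIsometryEquiv.norm_map]
  rfl

/-- The local boundedness of a map into the dual of a Hilbert space whose Gram kernel is separately
holomorphic. -/
theorem exists_bound_of_gram [CompleteSpace E] {S : Submodule ℂ F} (hS : Dense (S : Set F))
    {κ : E → StrongDual ℂ F} {X : Set E} (hX : IsOpen X)
    (hκS : ∀ y ∈ X, (InnerProductSpace.toDual ℂ F).symm (κ y) ∈ S)
    (hd : ∀ f ∈ S, DifferentiableOn ℂ (fun x => κ x f) X) {p : E} (hp : p ∈ X) :
    ∃ r > 0, ∃ M, ball p r ⊆ X ∧ ∀ x ∈ ball p r, ‖κ x‖ ≤ M := by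
  obtain ⟨r, hr, hball⟩ := Metric.isOpen_iff.mp hX p hp
  have hdat : ∀ f ∈ S, ∀ x ∈ X, DifferentiableAt ℂ (fun x => κ x f) x := fun f hf x hx =>
    (hd f hf x hx).differentiableAt (hX.mem_nhds hx)
  have hmem : ∀ u ∈ closedBall (0 : E) (r / 4), ∀ t ∈ ball (0 : ℂ) 2, p + t • u ∈ X := by
    intro u hu t ht
    apply hball
    rw [mem_closedBall_zero_iff] at hu
    rw [mem_ball_zero_iff] at ht
    rw [mem_ball, dist_eq_norm, add_sub_cancel_left, norm_smul]
    nlinarith [norm_nonneg t, norm_nonneg u]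
  have hline : ∀ u ∈ closedBall (0 : E) (r / 4), ∃ C, ∀ t ∈ closedBall (0 : ℂ) 1,
      ‖κ (p + t • u)‖ ≤ C := by
    intro u hu
    -- Along a line the Gram kernel is a Hermitian function of two complex variables whose diagonal
    -- is `‖κ‖ ^ 2`; the local bounds are patched by compactness.
    refine (isCompact_closedBall (0 : ℂ) 1).induction_on
      (p := fun s => ∃ C, ∀ t ∈ s, ‖κ (p + t • u)‖ ≤ C) ⟨0, by simp⟩ ?_ ?_ ?_
    · rintro s t hst ⟨C, hC⟩
      exact ⟨C, fun x hx => hC x (hst hx)⟩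
    · rintro s t ⟨C, hC⟩ ⟨D, hD⟩
      refine ⟨max C D, ?_⟩
      rintro x (hx | hx)
      · exact (hC x hx).trans (le_max_left _ _)
      · exact (hD x hx).trans (le_max_right _ _)
    · intro t₀ ht₀
      have hsub : ball t₀ 1 ⊆ ball (0 : ℂ) 2 := ball_subset_ball' (by
        rw [mem_closedBall] at ht₀; linarith)
      obtain ⟨δ, hδ, C, hC⟩ := exists_bound_diag
        (k := fun s t => dualInner (κ (p + s • u)) (κ (p + t • u))) (c := t₀) one_pos
        (fun t ht s hs => by
          simp only [dualInner_eq_apply]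
          refine (differentiableAt_comp_line (f := fun x => κ x _) ?_).differentiableWithinAt
          exact hdat _ (hκS _ (hmem u hu t (hsub ht))) _ (hmem u hu s (hsub hs)))
        (fun s _ t _ => (dualInner_conj_symm _ _).symm)
      refine ⟨ball t₀ δ, mem_nhdsWithin_of_mem_nhds (ball_mem_nhds _ hδ), √C, fun t ht => ?_⟩
      have := hC t ht
      rw [dualInner_self, norm_pow, Complex.norm_real, norm_norm] at this
      exact Real.le_sqrt_of_sq_le this
  -- Baire's theorem in the space of directions: one bound holds on the unit discs in all directions
  -- near some `u₀`.
  obtain ⟨N, u₀, hu₀, ε, hε, hN⟩ := exists_ball_subset_of_cover (c := (0 : E)) (r := r / 4)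
    (by positivity)
    (S := fun N : ℕ => closedBall (0 : E) (r / 4) ∩ ⋂ t ∈ closedBall (0 : ℂ) 1, ⋂ f ∈ S,
      {u | u ∈ closedBall (0 : E) (r / 4) ∧ ‖κ (p + t • u) f‖ ≤ N * ‖f‖})
    (fun N => by
      refine isClosed_closedBall.inter (isClosed_biInter fun t ht => isClosed_biInter fun f hf => ?_)
      have hcont : ContinuousOn (fun u => ‖κ (p + t • u) f‖) (closedBall (0 : E) (r / 4)) := by
        refine ContinuousOn.norm (ContinuousOn.comp (g := fun x => κ x f)
          (f := fun u => p + t • u) (t := X) (hd f hf).continuousOn (by fun_prop) ?_)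
        exact fun u hu => hmem u hu t (closedBall_subset_ball one_lt_two ht)
      exact hcont.preimage_isClosed_of_isClosed isClosed_closedBall isClosed_Iic)
    (fun u hu => by
      have hu' := ball_subset_closedBall hu
      obtain ⟨C, hC⟩ := hline u hu'
      obtain ⟨N, hN⟩ := exists_nat_ge C
      refine ⟨N, hu', mem_iInter₂.mpr fun t ht => mem_iInter₂.mpr fun f _ => ⟨hu', ?_⟩⟩
      exact (κ _).le_of_opNorm_le ((hC t ht).trans hN) f)
  have hN' : ∀ u ∈ ball u₀ ε, ∀ t ∈ closedBall (0 : ℂ) 1, ∀ f ∈ S,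
      ‖κ (p + t • u) f‖ ≤ N * ‖f‖ := fun u hu t ht f hf =>
    (mem_iInter₂.mp (mem_iInter₂.mp (hN hu).2 t ht) f hf).2
  refine ⟨min ε (r / 4), lt_min hε (by positivity), N, ?_, fun x hx => ?_⟩
  · exact (ball_subset_ball ((min_le_right _ _).trans (by linarith))).trans hball
  refine opNorm_le_of_dense_submodule hS (by positivity) fun f hf => ?_
  have hv : ‖x - p‖ < ε := by
    rw [← dist_eq_norm]; exact lt_of_lt_of_le hx (min_le_left _ _)
  have hv' : ‖x - p‖ < r / 4 := by
    rw [← dist_eq_norm]; exact lt_of_lt_of_le hx (min_le_right _ _)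
  rw [mem_ball_zero_iff] at hu₀
  have hX' : ∀ t ∈ ball (0 : ℂ) 2, x + t • u₀ ∈ X := by
    intro t ht
    rw [mem_ball_zero_iff] at ht
    apply hball
    rw [mem_ball, dist_eq_norm]
    have e : x + t • u₀ - p = (x - p) + t • u₀ := by abel
    have := norm_add_le (x - p) (t • u₀)
    rw [norm_smul] at this
    rw [e]
    nlinarith [norm_nonneg t, norm_nonneg u₀]
  have hdiff : DiffContOnCl ℂ (fun t : ℂ => κ (x + t • u₀) f) (ball 0 1) := by
    refine DifferentiableOn.diffContOnCl_ball (U := ball (0 : ℂ) 2) (fun t ht => ?_)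
      (closedBall_subset_ball one_lt_two)
    exact (differentiableAt_comp_line (f := fun x => κ x f)
      (hdat f hf _ (hX' t ht))).differentiableWithinAt
  have := Complex.norm_le_of_forall_mem_frontier_norm_le isBounded_ball hdiff
    (C := N * ‖f‖) (fun t ht => ?_) (subset_closure (mem_ball_self one_pos))
  · simpa using this
  · rw [frontier_ball _ one_ne_zero] at ht
    have htn : ‖t‖ = 1 := by simpa using ht
    have ht0 : t ≠ 0 := by
      rintro rfl
      simp at htn
    -- For `|t| = 1` a shift of the base point from `p` to `x` is a small change of direction, so
    -- the bound `N` holds on the boundary circle; the maximum principle carries it to `t = 0`, that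
    -- is, to `x`.
    have e : x + t • u₀ = p + t • (u₀ + t⁻¹ • (x - p)) := by
      rw [smul_add, smul_smul, mul_inv_cancel₀ ht0, one_smul]
      abel
    rw [e]
    refine hN' _ ?_ t (sphere_subset_closedBall ht) f hf
    rw [mem_ball, dist_eq_norm, add_sub_cancel_left, norm_smul, norm_inv, htn]
    simpa using hv

end WeakHolomorphy

/-! ### Holomorphy of the evaluation map. -/

section RKHS

theorem extendZero_coe {n : ℕ} {X : Set (EuclideanSpace ℂ (Fin n))} {V : Type*} [Zero V]
    (f : X → V) (x : X) : extendZero f x = f x :=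
  Subtype.val_injective.extend_apply f 0 x

theorem evalMap_apply {X : Type*} {F : Type*} [NormedAddCommGroup F] [InnerProductSpace ℂ F]
    [RKHS ℂ F X ℂ] (x : X) (f : F) : evalMap F x f = f x := rfl

theorem toDual_symm_evalMap {X : Type*} {F : Type*} [NormedAddCommGroup F]
    [InnerProductSpace ℂ F] [CompleteSpace F] [RKHS ℂ F X ℂ] (x : X) :
    (InnerProductSpace.toDual ℂ F).symm (evalMap F x) = RKHS.kerFun F x 1 := by
  refine (InnerProductSpace.toDual ℂ F).injective (ContinuousLinearMap.ext fun f => ?_)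
  rw [LinearIsometryEquiv.apply_symm_apply, InnerProductSpace.toDual_apply_apply,
    RKHS.kerFun_inner, evalMap_apply]
  simp

theorem dualInner_evalMap {X : Type*} {K : X → X → ℂ} [Fact (opKernel K).PosSemidef] (x y : X) :
    dualInner (evalMap (RKHS.OfKernel (opKernel K)) x) (evalMap (RKHS.OfKernel (opKernel K)) y) =
      K x y := by
  rw [dualInner_eq_apply, toDual_symm_evalMap, evalMap_apply, RKHS.kerFun_apply,
    RKHS.OfKernel.kernel_ofKernel]
  simp [opKernel]

variable {n : ℕ} {X : Set (EuclideanSpace ℂ (Fin n))}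

/-- The evaluation map of the reproducing kernel Hilbert space of a sesqui-holomorphic kernel is
holomorphic. -/
theorem differentiableAt_evalMap (hX : IsOpen X) {K : X → X → ℂ} [Fact (opKernel K).PosSemidef]
    (hK : IsSesquiHolomorphic K) {x : EuclideanSpace ℂ (Fin n)} (hx : x ∈ X) :
    DifferentiableAt ℂ (extendZero (evalMap (RKHS.OfKernel (opKernel K)))) x := by
  let F := RKHS.OfKernel (opKernel K)
  -- The span of the kernel sections is dense, contains the Riesz representatives of all
  -- evaluations, and consists of functions holomorphic on `X`.
  let S : Submodule ℂ F := Submodule.span ℂ {RKHS.kerFun F x v | (x) (v)}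
  have hS : Dense (S : Set F) :=
    Submodule.dense_iff_topologicalClosure_eq_top.mpr (RKHS.kerFun_dense F)
  have hκS : ∀ y ∈ X, (InnerProductSpace.toDual ℂ F).symm (extendZero (evalMap F) y) ∈ S := by
    intro y hy
    rw [extendZero_coe (evalMap F) ⟨y, hy⟩, toDual_symm_evalMap]
    exact Submodule.subset_span ⟨_, _, rfl⟩
  have hd : ∀ f ∈ S, DifferentiableOn ℂ (fun x => extendZero (evalMap F) x f) X := by
    intro f hf
    induction hf using Submodule.span_induction with
    | mem f hf =>
      obtain ⟨y, v, rfl⟩ := hf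
      refine ((hK.1 y).mul_const v).congr fun x hx => ?_
      rw [extendZero_coe _ ⟨x, hx⟩, extendZero_coe _ ⟨x, hx⟩, evalMap_apply, RKHS.kerFun_apply,
        RKHS.OfKernel.kernel_ofKernel]
      simp [opKernel]
    | zero => simp
    | add f g _ _ hf hg => simpa using hf.fun_add hg
    | smul a f _ hf => simpa using hf.const_mul a
  obtain ⟨r, hr, M, hsub, hM⟩ := exists_bound_of_gram hS hX hκS hd hx
  exact differentiableAt_of_bounded hS hr hM fun f hf => (hd f hf).mono hsub

end RKHS

/-! ### Algebra and calculus of the dual inner product. -/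

section DualInner

variable {F : Type*} [NormedAddCommGroup F] [InnerProductSpace ℂ F] [CompleteSpace F]

theorem dualInner_add_left (l m k : StrongDual ℂ F) :
    dualInner (l + m) k = dualInner l k + dualInner m k := by
  simp [dualInner_eq_apply]

theorem dualInner_smul_left (a : ℂ) (l m : StrongDual ℂ F) :
    dualInner (a • l) m = a * dualInner l m := by
  simp [dualInner_eq_apply]

theorem dualInner_add_right (l m k : StrongDual ℂ F) :
    dualInner l (m + k) = dualInner l m + dualInner l k := by
  simp [dualInner_eq_apply]

theorem dualInner_smul_right (a : ℂ) (l m : StrongDual ℂ F) :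
    dualInner l (a • m) = conj a * dualInner l m := by
  simp [dualInner_eq_apply, map_smulₛₗ]

theorem dualInner_self_ne_zero {l : StrongDual ℂ F} (hl : l ≠ 0) : dualInner l l ≠ 0 := by
  rw [dualInner_self]
  simpa using hl

theorem norm_dualInner_le (l m : StrongDual ℂ F) : ‖dualInner l m‖ ≤ ‖l‖ * ‖m‖ := by
  rw [dualInner_eq_apply]
  simpa using l.le_opNorm ((InnerProductSpace.toDual ℂ F).symm m)

theorem dualInner_mul_swap (l m : StrongDual ℂ F) :
    dualInner l m * dualInner m l = (‖dualInner l m‖ : ℂ) ^ 2 := by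
  rw [← dualInner_conj_symm m l, Complex.mul_conj, Complex.normSq_eq_norm_sq]
  simp

theorem fubiniStudy_eq (g f h : StrongDual ℂ F) :
    fubiniStudy g f h = (1 / dualInner g g) * dualInner f h -
      (1 / dualInner g g ^ 2) * (dualInner f g * dualInner g h) := by
  rw [fubiniStudy, dualInner_self]
  ring

/-- Invariance of the Fubini-Study form under rescaling of the base point. -/
theorem fubiniStudy_smul {g f h : StrongDual ℂ F} (hg : g ≠ 0) {a : ℂ} (ha : a ≠ 0) (b c : ℂ) :
    fubiniStudy (a • g) (a • f + b • g) (a • h + c • g) = fubiniStudy g f h := by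
  have hg' := dualInner_self_ne_zero hg
  have ha' : conj a ≠ 0 := by simpa using ha
  simp only [fubiniStudy_eq, dualInner_add_left, dualInner_smul_left, dualInner_add_right,
    dualInner_smul_right]
  field_simp
  ring

variable {E : Type*} [NormedAddCommGroup E] [NormedSpace ℂ E]

theorem differentiableAt_dualInner {α : E → StrongDual ℂ F} {x : E}
    (hα : DifferentiableAt ℂ α x) (m : StrongDual ℂ F) :
    DifferentiableAt ℂ (fun z => dualInner (α z) m) x := by
  simp only [dualInner_eq_apply]
  exact hα.clm_apply (differentiableAt_const _)

theorem fderiv_dualInner {α : E → StrongDual ℂ F} {x : E}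
    (hα : DifferentiableAt ℂ α x) (m : StrongDual ℂ F) (u : E) :
    fderiv ℂ (fun z => dualInner (α z) m) x u = dualInner (fderiv ℂ α x u) m := by
  simp only [dualInner_eq_apply]
  rw [fderiv_clm_apply hα (differentiableAt_const _)]
  simp

theorem hasDerivAt_dualInner {A : ℂ → StrongDual ℂ F} {t : ℂ}
    (hA : DifferentiableAt ℂ A t) (m : StrongDual ℂ F) :
    HasDerivAt (fun z => dualInner (A z) m) (dualInner (deriv A t) m) t := by
  simp only [dualInner_eq_apply]
  simpa using hA.hasDerivAt.clm_apply (hasDerivAt_const t _)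

theorem continuousAt_dualInner {Y : Type*} [TopologicalSpace Y] {α : Y → StrongDual ℂ F} {x y : Y}
    (hα : ContinuousAt α x) (hα' : ContinuousAt α y) :
    ContinuousAt (fun z : Y × Y => dualInner (α z.1) (α z.2)) (x, y) := by
  simp only [dualInner_eq_apply]
  refine ContinuousAt.clm_apply (hα.comp (f := Prod.fst) (x := (x, y)) continuousAt_fst) ?_
  exact (InnerProductSpace.toDual ℂ F).symm.continuous.continuousAt.comp
    (hα'.comp (f := Prod.snd) (x := (x, y)) continuousAt_snd)

/-- Conjugation of the parameter and the Riesz isometry are both antilinear, so together they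
preserve complex differentiability; as both preserve norms, the little-o estimate carries over. -/
theorem differentiableAt_toDual_symm_conj {G : ℂ → StrongDual ℂ F} {t : ℂ}
    (hG : DifferentiableAt ℂ G (conj t)) :
    DifferentiableAt ℂ (fun s => (InnerProductSpace.toDual ℂ F).symm (G (conj s))) t := by
  have h := hasDerivAt_iff_isLittleO.mp hG.hasDerivAt
  have hc : Tendsto (fun s : ℂ => conj s) (𝓝 t) (𝓝 (conj t)) := Complex.continuous_conj.tendsto t
  have h' := h.comp_tendsto hc
  refine (hasDerivAt_iff_isLittleO (f' := (InnerProductSpace.toDual ℂ F).symm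
    (deriv G (conj t))).mpr ?_).differentiableAt
  rw [← Asymptotics.isLittleO_norm_norm] at h' ⊢
  refine h'.congr (fun s => ?_) (fun s => ?_)
  · simp only [Function.comp_apply]
    rw [← LinearIsometryEquiv.norm_map (InnerProductSpace.toDual ℂ F).symm]
    simp [map_smulₛₗ]
  · simp only [Function.comp_apply]
    rw [← map_sub, RCLike.norm_conj]

/-- Gram kernels of holomorphic maps are holomorphic along `(m + s d, m + conj s d)`. -/
theorem differentiableAt_dualInner_conj_line {G H : E → StrongDual ℂ F} {m d : E} {t : ℂ}
    (hG : DifferentiableAt ℂ G (m + t • d)) (hH : DifferentiableAt ℂ H (m + conj t • d)) :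
    DifferentiableAt ℂ (fun s : ℂ => dualInner (G (m + s • d)) (H (m + conj s • d))) t := by
  simp only [dualInner_eq_apply]
  exact (differentiableAt_comp_line hG).clm_apply
    (differentiableAt_toDual_symm_conj (G := fun s => H (m + s • d)) (differentiableAt_comp_line hH))

end DualInner

/-! ### The rescaling defect and the construction of the rescaling factor. -/

section Hub

variable {E : Type*} [NormedAddCommGroup E] [NormedSpace ℂ E]
variable {F₁ : Type*} [NormedAddCommGroup F₁] [InnerProductSpace ℂ F₁] [CompleteSpace F₁]
variable {F₂ : Type*} [NormedAddCommGroup F₂] [InnerProductSpace ℂ F₂] [CompleteSpace F₂]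

/-- The defect from being rescalings of the Gram kernels of two maps, normalized at `p`. -/
noncomputable def rescalingDefect (α : E → StrongDual ℂ F₁) (β : E → StrongDual ℂ F₂) (p x y : E) : ℂ :=
  dualInner (β x) (β p) * dualInner (β p) (β y) * dualInner (α x) (α y) *
      dualInner (α p) (α p) -
    dualInner (α x) (α p) * dualInner (α p) (α y) * dualInner (β x) (β y) *
      dualInner (β p) (β p)

variable {α : E → StrongDual ℂ F₁} {β : E → StrongDual ℂ F₂} {X : Set E}

theorem conj_rescalingDefect {Y : Type*} (α : Y → StrongDual ℂ F₁) (β : Y → StrongDual ℂ F₂)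
    (p x y : Y) :
    conj (rescalingDefect α β p x y) = rescalingDefect α β p y x := by
  simp only [rescalingDefect, map_sub, map_mul, dualInner_conj_symm]
  ring

theorem differentiableAt_rescalingDefect {p x y : E} (hα : DifferentiableAt ℂ α x)
    (hβ : DifferentiableAt ℂ β x) :
    DifferentiableAt ℂ (fun z => rescalingDefect α β p z y) x := by
  unfold rescalingDefect
  have h1 := differentiableAt_dualInner hα (α p)
  have h2 := differentiableAt_dualInner hβ (β p)
  have h3 := differentiableAt_dualInner hα (α y)
  have h4 := differentiableAt_dualInner hβ (β y)
  exact (((h2.mul_const _).mul h3).mul_const _).sub (((h1.mul_const _).mul h4).mul_const _)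

/-- If the rescaling defect vanishes on the diagonal near `p`, it vanishes identically. -/
theorem rescalingDefect_eq_zero (hX : IsOpen X) (hc : IsPreconnected X)
    (hα : ∀ x ∈ X, DifferentiableAt ℂ α x) (hβ : ∀ x ∈ X, DifferentiableAt ℂ β x) {p : E}
    (hp : p ∈ X) (h0 : ∀ᶠ x in 𝓝 p, rescalingDefect α β p x x = 0) :
    ∀ x ∈ X, ∀ y ∈ X, rescalingDefect α β p x y = 0 := by
  obtain ⟨r, hr, hball⟩ := Metric.mem_nhds_iff.mp (inter_mem h0 (hX.mem_nhds hp))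
  have hloc : ∀ x ∈ ball p (r / 4), ∀ y ∈ ball p (r / 4), rescalingDefect α β p x y = 0 := by
    intro x hx y hy
    refine eq_zero_of_diag_eq_zero (fun m d t h1 h2 => ?_) (fun x hx => (hball hx).1) hx hy
    have h1 := (hball h1).2
    have h2 := (hball h2).2
    have a1 := differentiableAt_dualInner_conj_line (hα _ h1) (hα _ h2)
    have a2 := differentiableAt_dualInner_conj_line (hα _ h1) (differentiableAt_const (α p))
      (m := m) (d := d) (t := t)
    have a3 := differentiableAt_dualInner_conj_line (differentiableAt_const (α p)) (hα _ h2)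
      (m := m) (d := d) (t := t)
    have b1 := differentiableAt_dualInner_conj_line (hβ _ h1) (hβ _ h2)
    have b2 := differentiableAt_dualInner_conj_line (hβ _ h1) (differentiableAt_const (β p))
      (m := m) (d := d) (t := t)
    have b3 := differentiableAt_dualInner_conj_line (differentiableAt_const (β p)) (hβ _ h2)
      (m := m) (d := d) (t := t)
    unfold rescalingDefect
    exact (((b2.mul b3).mul a1).mul_const _).sub (((a2.mul a3).mul b1).mul_const _)
  have hr4 : 0 < r / 4 := by positivity
  have hdiff : ∀ y, DifferentiableOn ℂ (fun z => rescalingDefect α β p z y) X := fun y x hx =>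
    (differentiableAt_rescalingDefect (hα x hx) (hβ x hx)).differentiableWithinAt
  -- The identity theorem is applied in the first variable, then in the second after exchanging
  -- variables by Hermitian symmetry.
  have hhalf : ∀ y ∈ ball p (r / 4), ∀ x ∈ X, rescalingDefect α β p x y = 0 := by
    intro y hy
    refine eqOn_zero_of_eventually_zero hX hc (hdiff y) hp ?_
    filter_upwards [ball_mem_nhds p hr4] with x hx using hloc x hx y hy
  intro x hx y hy
  have := eqOn_zero_of_eventually_zero hX hc (hdiff x) hp (by
    filter_upwards [ball_mem_nhds p hr4] with z hz
    rw [← conj_rescalingDefect, hhalf z hz x hx, map_zero]) y hy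
  rw [← conj_rescalingDefect, this, map_zero]

/-- If the rescaling defect vanishes then the Gram kernels are rescalings of each other. -/
theorem exists_rescaling (hX : IsOpen X) (hc : IsPreconnected X)
    (hα : ∀ x ∈ X, DifferentiableAt ℂ α x) (hβ : ∀ x ∈ X, DifferentiableAt ℂ β x)
    (hα0 : ∀ x ∈ X, α x ≠ 0) (hβ0 : ∀ x ∈ X, β x ≠ 0) {p : E}
    (hp : p ∈ X) (h0 : ∀ x ∈ X, ∀ y ∈ X, rescalingDefect α β p x y = 0) :
    ∃ ω : E → ℂ, ∀ x ∈ X, ∀ y ∈ X,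
      dualInner (α x) (α y) = ω x * conj (ω y) * dualInner (β x) (β y) := by
  have hαp := dualInner_self_ne_zero (hα0 p hp)
  have hβp := dualInner_self_ne_zero (hβ0 p hp)
  have hnp : (‖α p‖ : ℂ) ≠ 0 := by simpa using hα0 p hp
  have hnp' : (‖β p‖ : ℂ) ≠ 0 := by simpa using hβ0 p hp
  have hdiff : ∀ m, DifferentiableOn ℂ (fun z => dualInner (α z) m) X := fun m x hx =>
    (differentiableAt_dualInner (hα x hx) m).differentiableWithinAt
  have hdiff' : ∀ m, DifferentiableOn ℂ (fun z => dualInner (β z) m) X := fun m x hx =>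
    (differentiableAt_dualInner (hβ x hx) m).differentiableWithinAt
  have hβU : ∀ x ∈ X, dualInner (α x) (α p) ≠ 0 → dualInner (β x) (β p) ≠ 0 := by
    intro x hx h hz
    have h1 := h0 x hx x hx
    have h2 : dualInner (α p) (α x) ≠ 0 := by
      rw [← dualInner_conj_symm]
      simpa using h
    rw [rescalingDefect, hz] at h1
    have := mul_ne_zero (mul_ne_zero (mul_ne_zero h h2) (dualInner_self_ne_zero (hβ0 x hx))) hβp
    apply this
    linear_combination -h1
  -- The constant is forced up to a phase by `|ω₀ p| ^ 2 = K(p, p) / L(p, p)`.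
  let ω₀ : E → ℂ := fun x => ‖β p‖ / ‖α p‖ * (dualInner (α x) (α p) / dualInner (β x) (β p))
  have hω₀ : ∀ x ∈ X, dualInner (α x) (α p) ≠ 0 → ω₀ x ≠ 0 := fun x hx h =>
    mul_ne_zero (div_ne_zero hnp' hnp) (div_ne_zero h (hβU x hx h))
  have hrel : ∀ x ∈ X, dualInner (α x) (α p) ≠ 0 → ∀ y ∈ X, dualInner (α y) (α p) ≠ 0 →
      dualInner (α x) (α y) = ω₀ x * conj (ω₀ y) * dualInner (β x) (β y) := by
    intro x hx hxU y hy hyU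
    have h1 := h0 x hx y hy
    have hbx := hβU x hx hxU
    have hby : dualInner (β p) (β y) ≠ 0 := by
      rw [← dualInner_conj_symm]
      simpa using hβU y hy hyU
    simp only [rescalingDefect, dualInner_self] at h1
    simp only [ω₀, map_mul, map_div₀, dualInner_conj_symm, Complex.conj_ofReal]
    field_simp
    linear_combination h1
  -- The zeros of `K(·, p)` have empty interior, so identities between holomorphic functions need
  -- only be checked off them.
  have hext : ∀ G : E → ℂ, DifferentiableOn ℂ G X →
      (∀ x ∈ X, dualInner (α x) (α p) ≠ 0 → G x = 0) → ∀ x ∈ X, G x = 0 := by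
    intro G hG hGU x hx
    by_contra hne
    obtain ⟨z, hz, hzU, hGz⟩ := exists_ne_zero_of_eventually hX hc (hdiff (α p)) hp hαp hx
      ((hG.continuousOn.continuousAt (hX.mem_nhds hx)).eventually_ne hne)
    exact hGz (hGU z hz hzU)
  have hexists : ∀ x : E, ∃ z, x ∈ X → z ∈ X ∧ dualInner (α z) (α p) ≠ 0 ∧
      dualInner (α z) (α x) ≠ 0 ∧ dualInner (β z) (β x) ≠ 0 := by
    intro x
    by_cases hx : x ∈ X
    · have e1 := (differentiableAt_dualInner (hα x hx) (α x)).continuousAt.eventually_ne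
        (dualInner_self_ne_zero (hα0 x hx))
      have e2 := (differentiableAt_dualInner (hβ x hx) (β x)).continuousAt.eventually_ne
        (dualInner_self_ne_zero (hβ0 x hx))
      obtain ⟨z, hz, hzU, hz'⟩ := exists_ne_zero_of_eventually hX hc (hdiff (α p)) hp hαp hx
        (e1.and e2)
      exact ⟨z, fun _ => ⟨hz, hzU, hz'⟩⟩
    · exact ⟨x, fun h => absurd h hx⟩
  choose q hq using hexists
  -- The value is dictated by the relation between `x` and a nearby point `q x` at which `ω₀`
  -- already works and where the kernels paired with `x` do not vanish.
  let ω : E → ℂ := fun x => dualInner (α x) (α (q x)) / (conj (ω₀ (q x)) * dualInner (β x) (β (q x)))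
  have hqβ : ∀ x ∈ X, dualInner (β x) (β (q x)) ≠ 0 := fun x hx => by
    rw [← dualInner_conj_symm]
    simpa using (hq x hx).2.2.2
  have hcω : ∀ x ∈ X, conj (ω₀ (q x)) ≠ 0 := fun x hx => by
    simpa using hω₀ _ (hq x hx).1 (hq x hx).2.1
  have hhalf : ∀ x ∈ X, ∀ z ∈ X, dualInner (α z) (α p) ≠ 0 →
      dualInner (α x) (α z) = ω x * conj (ω₀ z) * dualInner (β x) (β z) := by
    intro x hx z hz hzU
    obtain ⟨hqX, hqU, -, -⟩ := hq x hx
    -- The relation is cross-multiplied: in this form both sides are holomorphic in `w`, even where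
    -- `ω₀` is undefined.
    have key := hext (fun w => dualInner (α w) (α z) * (conj (ω₀ (q x)) *
        dualInner (β w) (β (q x))) - dualInner (α w) (α (q x)) * (conj (ω₀ z) *
        dualInner (β w) (β z)))
      (((hdiff _).mul ((hdiff' _).const_mul _)).sub ((hdiff _).mul ((hdiff' _).const_mul _)))
      (fun w hw hwU => by
        rw [hrel w hw hwU z hz hzU, hrel w hw hwU _ hqX hqU]
        ring) x hx
    have h1 := hqβ x hx
    have h2 := hcω x hx
    simp only [ω]
    field_simp
    linear_combination key
  refine ⟨ω, fun x hx y hy => ?_⟩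
  obtain ⟨hqX, hqU, -, -⟩ := hq y hy
  have key := hext (fun w => dualInner (α w) (α x) * (conj (ω₀ (q y)) *
      dualInner (β w) (β (q y))) - conj (ω x) * dualInner (α w) (α (q y)) * dualInner (β w) (β x))
    (((hdiff _).mul ((hdiff' _).const_mul _)).sub (((hdiff _).const_mul _).mul (hdiff' _)))
    (fun w hw hwU => by
      rw [← dualInner_conj_symm (α w) (α x), hhalf x hx w hw hwU, hrel w hw hwU _ hqX hqU]
      simp only [map_mul, Complex.conj_conj, dualInner_conj_symm]
      ring) y hy
  have h1 := hqβ y hy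
  have h2 := hcω y hy
  have key' : dualInner (α y) (α x) = ω y * conj (ω x) * dualInner (β y) (β x) := by
    simp only [ω] at key ⊢
    field_simp
    linear_combination key
  rw [← dualInner_conj_symm, key']
  simp only [map_mul, Complex.conj_conj, dualInner_conj_symm]
  ring

end Hub

/-! ### The Fubini-Study metric and the rescaling defect. -/

section Metrics

variable {E : Type*} [NormedAddCommGroup E] [NormedSpace ℂ E]
variable {F₁ : Type*} [NormedAddCommGroup F₁] [InnerProductSpace ℂ F₁] [CompleteSpace F₁]
variable {F₂ : Type*} [NormedAddCommGroup F₂] [InnerProductSpace ℂ F₂] [CompleteSpace F₂]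

/-- The polarized Fubini-Study metric pulled back along a holomorphic curve. -/
noncomputable def polarizedMetric (A : ℂ → StrongDual ℂ F₁) (s t : ℂ) : ℂ :=
  (dualInner (deriv A s) (deriv A t) * dualInner (A s) (A t) -
    dualInner (A s) (deriv A t) * dualInner (deriv A s) (A t)) / dualInner (A s) (A t) ^ 2

theorem polarizedMetric_self {A : ℂ → StrongDual ℂ F₁} {s : ℂ} (h : A s ≠ 0) :
    polarizedMetric A s s = fubiniStudy (A s) (deriv A s) (deriv A s) := by
  have := dualInner_self_ne_zero h
  rw [polarizedMetric, fubiniStudy_eq]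
  field_simp

/-- The quotient is the antiholomorphic logarithmic derivative in `t` of `⟨A s, A t⟩`, so the
polarized metric is a mixed derivative of a logarithm and can be integrated back. -/
theorem hasDerivAt_dualInner_div {A : ℂ → StrongDual ℂ F₁} {s t : ℂ}
    (hA : DifferentiableAt ℂ A s) (h : dualInner (A s) (A t) ≠ 0) :
    HasDerivAt (fun z => dualInner (A z) (deriv A t) / dualInner (A z) (A t))
      (polarizedMetric A s t) s :=
  (hasDerivAt_dualInner hA (deriv A t)).div (hasDerivAt_dualInner hA (A t)) h

theorem differentiableAt_polarizedMetric {A : ℂ → StrongDual ℂ F₁} {R : ℝ}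
    (hA : DifferentiableOn ℂ A (ball 0 R))
    (hA0 : ∀ s ∈ ball (0 : ℂ) R, ∀ t ∈ ball (0 : ℂ) R, dualInner (A s) (A t) ≠ 0) {m d t : ℂ}
    (h1 : m + t • d ∈ ball (0 : ℂ) R) (h2 : m + conj t • d ∈ ball (0 : ℂ) R) :
    DifferentiableAt ℂ (fun s : ℂ => polarizedMetric A (m + s • d) (m + conj s • d)) t := by
  have hA' : ∀ s ∈ ball (0 : ℂ) R, DifferentiableAt ℂ A s := fun s hs =>
    (hA s hs).differentiableAt (isOpen_ball.mem_nhds hs)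
  have hdA : ∀ s ∈ ball (0 : ℂ) R, DifferentiableAt ℂ (deriv A) s := fun s hs =>
    (hA.deriv isOpen_ball s hs).differentiableAt (isOpen_ball.mem_nhds hs)
  have a1 := differentiableAt_dualInner_conj_line (hA' _ h1) (hA' _ h2)
  have a2 := differentiableAt_dualInner_conj_line (hdA _ h1) (hdA _ h2)
  have a3 := differentiableAt_dualInner_conj_line (hA' _ h1) (hdA _ h2)
  have a4 := differentiableAt_dualInner_conj_line (hdA _ h1) (hA' _ h2)
  exact ((a2.mul a1).sub (a3.mul a4)).div (a1.pow 2) (pow_ne_zero 2 (hA0 _ h1 _ h2))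

/-- Two holomorphic curves with the same Fubini-Study metric have vanishing rescaling defect. -/
theorem rescalingDefect_curve_eq_zero {A : ℂ → StrongDual ℂ F₁} {B : ℂ → StrongDual ℂ F₂} {R : ℝ}
    (hA : DifferentiableOn ℂ A (ball 0 R)) (hB : DifferentiableOn ℂ B (ball 0 R))
    (hA0 : ∀ s ∈ ball (0 : ℂ) R, ∀ t ∈ ball (0 : ℂ) R, dualInner (A s) (A t) ≠ 0)
    (hB0 : ∀ s ∈ ball (0 : ℂ) R, ∀ t ∈ ball (0 : ℂ) R, dualInner (B s) (B t) ≠ 0)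
    (hσ : ∀ s ∈ ball (0 : ℂ) R, fubiniStudy (A s) (deriv A s) (deriv A s) =
      fubiniStudy (B s) (deriv B s) (deriv B s)) {s : ℂ} (hs : s ∈ ball (0 : ℂ) (R / 4)) :
    rescalingDefect A B 0 s s = 0 := by
  have hR : 0 < R / 4 := nonempty_ball.mp ⟨s, hs⟩
  have hsub : ball (0 : ℂ) (R / 4) ⊆ ball 0 R := ball_subset_ball (by linarith)
  have h0 : (0 : ℂ) ∈ ball (0 : ℂ) (R / 4) := mem_ball_self hR
  have hA' : ∀ s ∈ ball (0 : ℂ) (R / 4), DifferentiableAt ℂ A s := fun s hs =>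
    (hA s (hsub hs)).differentiableAt (isOpen_ball.mem_nhds (hsub hs))
  have hB' : ∀ s ∈ ball (0 : ℂ) (R / 4), DifferentiableAt ℂ B s := fun s hs =>
    (hB s (hsub hs)).differentiableAt (isOpen_ball.mem_nhds (hsub hs))
  have hA1 : ∀ s ∈ ball (0 : ℂ) (R / 4), ∀ t ∈ ball (0 : ℂ) (R / 4), dualInner (A s) (A t) ≠ 0 :=
    fun s hs t ht => hA0 s (hsub hs) t (hsub ht)
  have hB1 : ∀ s ∈ ball (0 : ℂ) (R / 4), ∀ t ∈ ball (0 : ℂ) (R / 4), dualInner (B s) (B t) ≠ 0 :=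
    fun s hs t ht => hB0 s (hsub hs) t (hsub ht)
  have hne : ∀ s ∈ ball (0 : ℂ) R, A s ≠ 0 ∧ B s ≠ 0 := by
    refine fun s hs => ⟨fun h => hA0 s hs s hs ?_, fun h => hB0 s hs s hs ?_⟩ <;>
    simp [h, dualInner_eq_apply]
  have hW : ∀ s ∈ ball (0 : ℂ) (R / 4), ∀ t ∈ ball (0 : ℂ) (R / 4),
      polarizedMetric A s t = polarizedMetric B s t := by
    intro s hs t ht
    refine sub_eq_zero.mp (eq_zero_of_diag_eq_zero (p := (0 : ℂ)) (r := R)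
      (Φ := fun s t => polarizedMetric A s t - polarizedMetric B s t) (fun m d t h1 h2 => ?_)
      (fun x hx => ?_) hs ht)
    · exact (differentiableAt_polarizedMetric hA hA0 h1 h2).sub
        (differentiableAt_polarizedMetric hB hB0 h1 h2)
    · simp only [polarizedMetric_self (hne x hx).1, polarizedMetric_self (hne x hx).2, hσ x hx,
        sub_self]
  -- First integration, in `s`: the logarithmic derivatives in `t` differ by a function of `t`
  -- alone.
  have hconst : ∀ s ∈ ball (0 : ℂ) (R / 4), ∀ t ∈ ball (0 : ℂ) (R / 4),
      dualInner (A s) (deriv A t) / dualInner (A s) (A t) -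
        dualInner (B s) (deriv B t) / dualInner (B s) (B t) =
      dualInner (A 0) (deriv A t) / dualInner (A 0) (A t) -
        dualInner (B 0) (deriv B t) / dualInner (B 0) (B t) := by
    intro s hs t ht
    have hder : ∀ z ∈ ball (0 : ℂ) (R / 4), HasDerivAt (fun z =>
        dualInner (A z) (deriv A t) / dualInner (A z) (A t) -
          dualInner (B z) (deriv B t) / dualInner (B z) (B t)) 0 z := fun z hz => by
      have := (hasDerivAt_dualInner_div (hA' z hz) (hA1 z hz t ht)).sub
        (hasDerivAt_dualInner_div (hB' z hz) (hB1 z hz t ht))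
      rw [hW z hz t ht, sub_self] at this
      exact this
    exact isOpen_ball.is_const_of_deriv_eq_zero (convex_ball _ _).isPreconnected
      (fun z hz => (hder z hz).differentiableAt.differentiableWithinAt)
      (fun z hz => (hder z hz).deriv) hs h0
  -- Second integration, after conjugation and without logarithms: this cross-ratio is constant in
  -- `t`, and comparing `t = s` with `t = 0` gives the vanishing defect.
  have hder : ∀ t ∈ ball (0 : ℂ) (R / 4), HasDerivAt (fun t =>
      (dualInner (A t) (A s) * dualInner (B t) (B 0)) /
        (dualInner (B t) (B s) * dualInner (A t) (A 0))) 0 t := by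
    intro t ht
    have hc := congrArg conj (hconst s hs t ht)
    simp only [map_sub, map_div₀, dualInner_conj_symm] at hc
    have n1 := hA1 t ht s hs
    have n2 := hA1 t ht 0 h0
    have n3 := hB1 t ht s hs
    have n4 := hB1 t ht 0 h0
    have := ((hasDerivAt_dualInner (hA' t ht) (A s)).mul
      (hasDerivAt_dualInner (hB' t ht) (B 0))).div
      ((hasDerivAt_dualInner (hB' t ht) (B s)).mul
      (hasDerivAt_dualInner (hA' t ht) (A 0))) (mul_ne_zero n3 n2)
    refine this.congr_deriv ?_
    rw [div_eq_zero_iff]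
    left
    field_simp at hc
    simp only [Pi.mul_apply]
    linear_combination hc
  have hfin := isOpen_ball.is_const_of_deriv_eq_zero (convex_ball _ _).isPreconnected
    (fun z hz => (hder z hz).differentiableAt.differentiableWithinAt)
    (fun z hz => (hder z hz).deriv) hs h0
  have n1 := hA1 s hs 0 h0
  have n2 := hA1 0 h0 0 h0
  have n3 := hB1 s hs s hs
  have n4 := hB1 0 h0 s hs
  rw [div_eq_div_iff (mul_ne_zero n3 n1) (mul_ne_zero n4 n2)] at hfin
  rw [rescalingDefect]
  linear_combination hfin

variable {α : E → StrongDual ℂ F₁} {β : E → StrongDual ℂ F₂} {X : Set E}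

/-- Maps with the same pulled back Fubini-Study metric have vanishing rescaling defect near each
point of the diagonal. -/
theorem eventually_rescalingDefect_eq_zero (hX : IsOpen X)
    (hα : ∀ x ∈ X, DifferentiableAt ℂ α x) (hβ : ∀ x ∈ X, DifferentiableAt ℂ β x)
    {p : E} (hp : p ∈ X) (hαp : α p ≠ 0) (hβp : β p ≠ 0)
    (hσ : ∀ x ∈ X, ∀ u, fubiniStudy (α x) (fderiv ℂ α x u) (fderiv ℂ α x u) =
      fubiniStudy (β x) (fderiv ℂ β x u) (fderiv ℂ β x u)) :
    ∀ᶠ x in 𝓝 p, rescalingDefect α β p x x = 0 := by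
  have e1 := (continuousAt_dualInner (hα p hp).continuousAt (hα p hp).continuousAt).eventually_ne
    (dualInner_self_ne_zero hαp)
  have e2 := (continuousAt_dualInner (hβ p hp).continuousAt (hβ p hp).continuousAt).eventually_ne
    (dualInner_self_ne_zero hβp)
  obtain ⟨r₁, hr₁, hball₁⟩ := Metric.mem_nhds_iff.mp (e1.and e2)
  obtain ⟨r₂, hr₂, hball₂⟩ := Metric.isOpen_iff.mp hX p hp
  have hr : 0 < min r₁ r₂ := lt_min hr₁ hr₂
  -- The result on curves reaches only a quarter of the parameter radius, so radius `8` makes `s =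
  -- 1`, that is, the point `x`, available.
  filter_upwards [ball_mem_nhds p (show 0 < min r₁ r₂ / 8 by positivity)] with x hx
  have hmem : ∀ s ∈ ball (0 : ℂ) 8, p + s • (x - p) ∈ ball p (min r₁ r₂) := by
    intro s hs
    rw [mem_ball, dist_eq_norm] at hx ⊢
    rw [mem_ball_zero_iff] at hs
    rw [add_sub_cancel_left, norm_smul]
    nlinarith [norm_nonneg s, norm_nonneg (x - p)]
  have hmemX : ∀ s ∈ ball (0 : ℂ) 8, p + s • (x - p) ∈ X := fun s hs =>
    hball₂ (ball_subset_ball (min_le_right _ _) (hmem s hs))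
  have hmem₁ : ∀ s ∈ ball (0 : ℂ) 8, ∀ t ∈ ball (0 : ℂ) 8,
      (p + s • (x - p), p + t • (x - p)) ∈ ball (p, p) r₁ := by
    intro s hs t ht
    rw [← ball_prod_same]
    exact ⟨ball_subset_ball (min_le_left _ _) (hmem s hs),
      ball_subset_ball (min_le_left _ _) (hmem t ht)⟩
  have hderiv : ∀ s : ℂ, HasDerivAt (fun s : ℂ => p + s • (x - p)) (x - p) s := fun s => by
    simpa using ((hasDerivAt_id s).smul_const (x - p)).const_add p
  have hA : ∀ s ∈ ball (0 : ℂ) 8, HasDerivAt (fun s : ℂ => α (p + s • (x - p)))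
      (fderiv ℂ α (p + s • (x - p)) (x - p)) s := fun s hs =>
    (hα _ (hmemX s hs)).hasFDerivAt.comp_hasDerivAt s (hderiv s)
  have hB : ∀ s ∈ ball (0 : ℂ) 8, HasDerivAt (fun s : ℂ => β (p + s • (x - p)))
      (fderiv ℂ β (p + s • (x - p)) (x - p)) s := fun s hs =>
    (hβ _ (hmemX s hs)).hasFDerivAt.comp_hasDerivAt s (hderiv s)
  have key := rescalingDefect_curve_eq_zero (A := fun s : ℂ => α (p + s • (x - p)))
    (B := fun s : ℂ => β (p + s • (x - p))) (R := 8)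
    (fun s hs => (hA s hs).differentiableAt.differentiableWithinAt)
    (fun s hs => (hB s hs).differentiableAt.differentiableWithinAt)
    (fun s hs t ht => (hball₁ (hmem₁ s hs t ht)).1)
    (fun s hs t ht => (hball₁ (hmem₁ s hs t ht)).2)
    (fun s hs => by
      rw [(hA s hs).deriv, (hB s hs).deriv]
      exact hσ _ (hmemX s hs) _) (s := 1) (by simp; norm_num)
  simpa [rescalingDefect] using key

/-- Maps with the same Gram kernel have the same pulled back Fubini-Study metric. -/
theorem fubiniStudy_eq_of_gram_eq {p : E} (hα : DifferentiableAt ℂ α p)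
    (hβ : DifferentiableAt ℂ β p)
    (h : ∀ᶠ x in 𝓝 p, ∀ᶠ y in 𝓝 p, dualInner (α y) (α x) = dualInner (β y) (β x)) (u v : E) :
    fubiniStudy (α p) (fderiv ℂ α p u) (fderiv ℂ α p v) =
      fubiniStudy (β p) (fderiv ℂ β p u) (fderiv ℂ β p v) := by
  -- The Gram identity is differentiated in one slot with the other free, conjugated, and
  -- differentiated again.
  have h1 : ∀ u, ∀ᶠ x in 𝓝 p,
      dualInner (fderiv ℂ α p u) (α x) = dualInner (fderiv ℂ β p u) (β x) := by
    intro u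
    filter_upwards [h] with x hx
    rw [← fderiv_dualInner hα, ← fderiv_dualInner hβ]
    exact DFunLike.congr_fun (EventuallyEq.fderiv_eq (𝕜 := ℂ) hx) u
  have h1' : ∀ u, ∀ᶠ x in 𝓝 p,
      dualInner (α x) (fderiv ℂ α p u) = dualInner (β x) (fderiv ℂ β p u) := by
    intro u
    filter_upwards [h1 u] with x hx
    rw [← dualInner_conj_symm, hx, dualInner_conj_symm]
  have h2 : dualInner (fderiv ℂ α p u) (fderiv ℂ α p v) =
      dualInner (fderiv ℂ β p u) (fderiv ℂ β p v) := by
    rw [← fderiv_dualInner hα, ← fderiv_dualInner hβ]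
    exact DFunLike.congr_fun (EventuallyEq.fderiv_eq (𝕜 := ℂ) (h1' v)) u
  have h3 : dualInner (α p) (α p) = dualInner (β p) (β p) := h.self_of_nhds.self_of_nhds
  rw [fubiniStudy_eq, fubiniStudy_eq, h2, h3, (h1 u).self_of_nhds, (h1' v).self_of_nhds]

/-- Rescalings have the same pulled back Fubini-Study metric. -/
theorem fubiniStudy_eq_of_rescaling (hX : IsOpen X) (hα : ∀ x ∈ X, DifferentiableAt ℂ α x)
    (hβ : ∀ x ∈ X, DifferentiableAt ℂ β x) {p : E} (hp : p ∈ X) (hαp : α p ≠ 0)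
    {ω : E → ℂ} (hω : ∀ x ∈ X, ∀ y ∈ X,
      dualInner (α x) (α y) = ω x * conj (ω y) * dualInner (β x) (β y)) (u v : E) :
    fubiniStudy (α p) (fderiv ℂ α p u) (fderiv ℂ α p v) =
      fubiniStudy (β p) (fderiv ℂ β p u) (fderiv ℂ β p v) := by
  have hne := dualInner_self_ne_zero hαp
  rw [hω p hp p hp] at hne
  have hωp : ω p ≠ 0 := fun h => hne (by simp [h])
  have hωp' : conj (ω p) ≠ 0 := by simpa using hωp
  have hβpp : dualInner (β p) (β p) ≠ 0 := right_ne_zero_of_mul hne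
  have hβp : β p ≠ 0 := fun h => hβpp (by simp [h, dualInner_eq_apply])
  -- Freezing the second variable at `p` exhibits `ω` near `p` as a quotient of holomorphic
  -- functions. Hence `ω β` is holomorphic with the same Gram kernel as `α`, and the term with the
  -- derivative of `ω` is parallel to `β p`, which the metric ignores.
  have hdω : DifferentiableAt ℂ ω p := by
    have h1 := differentiableAt_dualInner (hβ p hp) (β p)
    have h2 : DifferentiableAt ℂ (fun x => dualInner (α x) (α p) /
        (conj (ω p) * dualInner (β x) (β p))) p := by
      simp only [div_eq_mul_inv]
      exact (differentiableAt_dualInner (hα p hp) (α p)).mul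
        ((h1.const_mul _).inv (mul_ne_zero hωp' hβpp))
    refine h2.congr_of_eventuallyEq ?_
    filter_upwards [hX.mem_nhds hp, h1.continuousAt.eventually_ne hβpp] with x hx hxne
    rw [hω x hx p hp]
    field_simp
  have hdγ : DifferentiableAt ℂ (fun x => ω x • β x) p := hdω.smul (hβ p hp)
  have hfd : ∀ u, fderiv ℂ (fun x => ω x • β x) p u =
      ω p • fderiv ℂ β p u + (fderiv ℂ ω p u) • β p := by
    intro u
    rw [fderiv_fun_smul hdω (hβ p hp)]
    simp
  rw [fubiniStudy_eq_of_gram_eq (β := fun x => ω x • β x) (hα p hp) hdγ ?_ u v, hfd, hfd,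
    fubiniStudy_smul hβp hωp]
  filter_upwards [hX.mem_nhds hp] with x hx
  filter_upwards [hX.mem_nhds hp] with y hy
  rw [hω y hy x hx, dualInner_smul_left, dualInner_smul_right]
  ring

end Metrics

/-! ### The two distances and the rescaling defect. -/

section Distances

variable {F : Type*} [NormedAddCommGroup F] [InnerProductSpace ℂ F] [CompleteSpace F]

theorem norm_dualInner_div_le_one (l m : StrongDual ℂ F) :
    ‖dualInner l m‖ / (‖l‖ * ‖m‖) ≤ 1 :=
  div_le_one_of_le₀ (norm_dualInner_le l m) (by positivity)

variable {F' : Type*} [NormedAddCommGroup F'] [InnerProductSpace ℂ F'] [CompleteSpace F']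

/-- By Cauchy-Schwarz the normalized modulus lies in `[0, 1]`, so the radicand is nonnegative and
the distance is an injective function of it. -/
theorem delta₁_eq_iff (l m : StrongDual ℂ F) (l' m' : StrongDual ℂ F') :
    delta₁ l m = delta₁ l' m' ↔
      ‖dualInner l m‖ / (‖l‖ * ‖m‖) = ‖dualInner l' m'‖ / (‖l'‖ * ‖m'‖) := by
  have h1 : (‖dualInner l m‖ / (‖l‖ * ‖m‖)) ^ 2 ≤ 1 :=
    pow_le_one₀ (by positivity) (norm_dualInner_div_le_one l m)
  have h2 : (‖dualInner l' m'‖ / (‖l'‖ * ‖m'‖)) ^ 2 ≤ 1 :=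
    pow_le_one₀ (by positivity) (norm_dualInner_div_le_one l' m')
  rw [delta₁, delta₁, ← mul_pow, ← mul_pow, ← div_pow, ← div_pow,
    Real.sqrt_inj (by linarith) (by linarith), sub_right_inj,
    pow_left_inj₀ (by positivity) (by positivity) two_ne_zero]

theorem delta₂_eq_iff (l m : StrongDual ℂ F) (l' m' : StrongDual ℂ F') :
    delta₂ l m = delta₂ l' m' ↔
      ‖dualInner l m‖ / (‖l‖ * ‖m‖) = ‖dualInner l' m'‖ / (‖l'‖ * ‖m'‖) := by
  have h1 := norm_dualInner_div_le_one l m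
  have h2 := norm_dualInner_div_le_one l' m'
  rw [delta₂, delta₂, Real.sqrt_inj (by linarith) (by linarith), sub_right_inj]
  exact mul_right_inj' two_ne_zero

variable {Y : Type*} {α : Y → StrongDual ℂ F} {β : Y → StrongDual ℂ F'}

/-- The diagonal relation gives `‖α a‖ = ‖ω a‖ * ‖β a‖`, and the factors cancel. -/
theorem norm_dualInner_div_eq_of_rescaling {ω : Y → ℂ} {x y : Y}
    (hω : ∀ a ∈ ({x, y} : Set Y), ∀ b ∈ ({x, y} : Set Y),
      dualInner (α a) (α b) = ω a * conj (ω b) * dualInner (β a) (β b))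
    (hx : α x ≠ 0) (hy : α y ≠ 0) :
    ‖dualInner (α x) (α y)‖ / (‖α x‖ * ‖α y‖) = ‖dualInner (β x) (β y)‖ / (‖β x‖ * ‖β y‖) := by
  have hn : ∀ a ∈ ({x, y} : Set Y), ‖α a‖ = ‖ω a‖ * ‖β a‖ := by
    intro a ha
    have := congrArg norm (hω a ha a ha)
    rw [dualInner_self, dualInner_self] at this
    simp only [norm_pow, norm_mul, Complex.norm_real, norm_norm, RCLike.norm_conj] at this
    rw [← pow_left_inj₀ (norm_nonneg _) (by positivity) two_ne_zero, this]
    ring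
  have hx' := norm_pos_iff.mpr hx
  have hy' := norm_pos_iff.mpr hy
  rw [hn x (by simp)] at hx'
  rw [hn y (by simp)] at hy'
  have a1 : ‖ω x‖ ≠ 0 := left_ne_zero_of_mul hx'.ne'
  have a2 : ‖ω y‖ ≠ 0 := left_ne_zero_of_mul hy'.ne'
  have a3 : ‖β x‖ ≠ 0 := right_ne_zero_of_mul hx'.ne'
  have a4 : ‖β y‖ ≠ 0 := right_ne_zero_of_mul hy'.ne'
  rw [hω x (by simp) y (by simp), hn x (by simp), hn y (by simp)]
  simp only [norm_mul, RCLike.norm_conj]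
  field_simp

/-- On the diagonal the defect is `|L(x, p)|² K(x, x) K(p, p) - |K(x, p)|² L(x, x) L(p, p)`, so it
vanishes by cross-multiplying and squaring the hypothesis. -/
theorem rescalingDefect_self_eq_zero {p x : Y} (hαp : α p ≠ 0) (hβp : β p ≠ 0) (hαx : α x ≠ 0)
    (hβx : β x ≠ 0)
    (h : ‖dualInner (α x) (α p)‖ / (‖α x‖ * ‖α p‖) =
      ‖dualInner (β x) (β p)‖ / (‖β x‖ * ‖β p‖)) :
    rescalingDefect α β p x x = 0 := by
  have a1 : (‖α x‖ : ℂ) ≠ 0 := by simpa using hαx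
  have a2 : (‖α p‖ : ℂ) ≠ 0 := by simpa using hαp
  have a3 : (‖β x‖ : ℂ) ≠ 0 := by simpa using hβx
  have a4 : (‖β p‖ : ℂ) ≠ 0 := by simpa using hβp
  have h' := congrArg (fun r : ℝ => (r : ℂ)) h
  push_cast at h'
  rw [div_eq_div_iff (mul_ne_zero a1 a2) (mul_ne_zero a3 a4)] at h'
  have hsq : (_ : ℂ) ^ 2 = _ ^ 2 := congrArg (· ^ 2) h'
  rw [rescalingDefect, dualInner_mul_swap, dualInner_mul_swap]
  simp only [dualInner_self]
  linear_combination -hsq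

end Distances

end KernelMetric

/-! ### The equivalence. -/

open KernelMetric

theorem mainTheorem4 (n : ℕ) (X : Set (EuclideanSpace ℂ (Fin n)))
    (hXopen : IsOpen X) (hXconn : IsConnected X)
    (K L : X → X → ℂ)
    (hKhol : KernelMetric.IsSesquiHolomorphic K) (hLhol : KernelMetric.IsSesquiHolomorphic L)
    (hKnd : KernelMetric.IsNondegenerate K) (hLnd : KernelMetric.IsNondegenerate L)
    (hKpsd : KernelMetric.IsPosSemidefKernel K) (hLpsd : KernelMetric.IsPosSemidefKernel L) :
    List.TFAE [
      KernelMetric.AreRescalings K L,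
      KernelMetric.fubiniStudyPullback K hKpsd = KernelMetric.fubiniStudyPullback L hLpsd,
      KernelMetric.delta₁Pullback K hKpsd = KernelMetric.delta₁Pullback L hLpsd,
      KernelMetric.delta₂Pullback K hKpsd = KernelMetric.delta₂Pullback L hLpsd] := by
  have : Fact (opKernel K).PosSemidef := ⟨hKpsd.opKernel_posSemidef⟩
  have : Fact (opKernel L).PosSemidef := ⟨hLpsd.opKernel_posSemidef⟩
  set α := extendZero (evalMap (RKHS.OfKernel (opKernel K)) : X → _)
  set β := extendZero (evalMap (RKHS.OfKernel (opKernel L)) : X → _)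
  have hαe : ∀ x : X, evalMap (RKHS.OfKernel (opKernel K)) x = α x := fun x =>
    (extendZero_coe _ x).symm
  have hβe : ∀ x : X, evalMap (RKHS.OfKernel (opKernel L)) x = β x := fun x =>
    (extendZero_coe _ x).symm
  have hα : ∀ x ∈ X, DifferentiableAt ℂ α x := fun x hx =>
    differentiableAt_evalMap hXopen hKhol hx
  have hβ : ∀ x ∈ X, DifferentiableAt ℂ β x := fun x hx =>
    differentiableAt_evalMap hXopen hLhol hx
  have hK : ∀ x y : X, dualInner (α x) (α y) = K x y := fun x y => by
    rw [← hαe, ← hαe, dualInner_evalMap]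
  have hL : ∀ x y : X, dualInner (β x) (β y) = L x y := fun x y => by
    rw [← hβe, ← hβe, dualInner_evalMap]
  have hα0 : ∀ x ∈ X, α x ≠ 0 := fun x hx h => by
    have := hKnd ⟨x, hx⟩
    rw [← hK] at this
    simp [h, dualInner_eq_apply] at this
  have hβ0 : ∀ x ∈ X, β x ≠ 0 := fun x hx h => by
    have := hLnd ⟨x, hx⟩
    rw [← hL] at this
    simp [h, dualInner_eq_apply] at this
  obtain ⟨p, hp⟩ := hXconn.nonempty
  have hσ : fubiniStudyPullback K hKpsd = fubiniStudyPullback L hLpsd ↔ ∀ x ∈ X, ∀ u v,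
      fubiniStudy (α x) (fderiv ℂ α x u) (fderiv ℂ α x v) =
        fubiniStudy (β x) (fderiv ℂ β x u) (fderiv ℂ β x v) := by
    have e1 : ∀ (x : X) u v, fubiniStudyPullback K hKpsd x u v =
        fubiniStudy (α x) (fderiv ℂ α x u) (fderiv ℂ α x v) := fun x u v => by
      rw [← hαe]
      rfl
    have e2 : ∀ (x : X) u v, fubiniStudyPullback L hLpsd x u v =
        fubiniStudy (β x) (fderiv ℂ β x u) (fderiv ℂ β x v) := fun x u v => by
      rw [← hβe]
      rfl
    constructor
    · intro h x hx u v
      rw [← e1 ⟨x, hx⟩, ← e2 ⟨x, hx⟩, h]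
    · intro h
      ext x u v
      rw [e1, e2, h x x.2]
  have hδ₁ : delta₁Pullback K hKpsd = delta₁Pullback L hLpsd ↔ ∀ x ∈ X, ∀ y ∈ X,
      ‖dualInner (α x) (α y)‖ / (‖α x‖ * ‖α y‖) =
        ‖dualInner (β x) (β y)‖ / (‖β x‖ * ‖β y‖) := by
    constructor
    · intro h x hx y hy
      rw [← delta₁_eq_iff]
      have := congrFun (congrFun h ⟨x, hx⟩) ⟨y, hy⟩
      simp only [delta₁Pullback, hαe, hβe] at this
      exact this
    · intro h
      ext x y
      simp only [delta₁Pullback, hαe, hβe]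
      exact (delta₁_eq_iff _ _ _ _).mpr (h x x.2 y y.2)
  have hδ₂ : delta₂Pullback K hKpsd = delta₂Pullback L hLpsd ↔ ∀ x ∈ X, ∀ y ∈ X,
      ‖dualInner (α x) (α y)‖ / (‖α x‖ * ‖α y‖) =
        ‖dualInner (β x) (β y)‖ / (‖β x‖ * ‖β y‖) := by
    constructor
    · intro h x hx y hy
      rw [← delta₂_eq_iff]
      have := congrFun (congrFun h ⟨x, hx⟩) ⟨y, hy⟩
      simp only [delta₂Pullback, hαe, hβe] at this
      exact this
    · intro h
      ext x y
      simp only [delta₂Pullback, hαe, hβe]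
      exact (delta₂_eq_iff _ _ _ _).mpr (h x x.2 y y.2)
  have hdefect : (∀ᶠ x in 𝓝 p, rescalingDefect α β p x x = 0) → AreRescalings K L := by
    intro h
    obtain ⟨ω, hω⟩ := exists_rescaling hXopen hXconn.isPreconnected hα hβ hα0 hβ0 hp
      (rescalingDefect_eq_zero hXopen hXconn.isPreconnected hα hβ hp h)
    refine Or.inr ⟨fun x => ω x, fun x y => ?_⟩
    rw [← hK, ← hL, hω x x.2 y y.2]
  have hresc : AreRescalings K L →
      (∀ x ∈ X, ∀ u v, fubiniStudy (α x) (fderiv ℂ α x u) (fderiv ℂ α x v) =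
        fubiniStudy (β x) (fderiv ℂ β x u) (fderiv ℂ β x v)) ∧
      ∀ x ∈ X, ∀ y ∈ X, ‖dualInner (α x) (α y)‖ / (‖α x‖ * ‖α y‖) =
        ‖dualInner (β x) (β y)‖ / (‖β x‖ * ‖β y‖) := by
    rintro (⟨ω, hω⟩ | ⟨ω, hω⟩)
    · have hω' : ∀ x ∈ X, ∀ y ∈ X, dualInner (β x) (β y) =
          extendZero ω x * conj (extendZero ω y) * dualInner (α x) (α y) := by
        intro x hx y hy
        rw [hK ⟨x, hx⟩ ⟨y, hy⟩, hL ⟨x, hx⟩ ⟨y, hy⟩, extendZero_coe ω ⟨x, hx⟩,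
          extendZero_coe ω ⟨y, hy⟩, hω]
      refine ⟨fun x hx u v =>
        (fubiniStudy_eq_of_rescaling hXopen hβ hα hx (hβ0 x hx) hω' u v).symm, fun x hx y hy => ?_⟩
      refine (norm_dualInner_div_eq_of_rescaling (ω := extendZero ω) ?_ (hβ0 x hx)
        (hβ0 y hy)).symm
      rintro a (rfl | rfl) b (rfl | rfl) <;> exact hω' _ ‹_› _ ‹_›
    · have hω' : ∀ x ∈ X, ∀ y ∈ X, dualInner (α x) (α y) =
          extendZero ω x * conj (extendZero ω y) * dualInner (β x) (β y) := by
        intro x hx y hy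
        rw [hK ⟨x, hx⟩ ⟨y, hy⟩, hL ⟨x, hx⟩ ⟨y, hy⟩, extendZero_coe ω ⟨x, hx⟩,
          extendZero_coe ω ⟨y, hy⟩, hω]
      refine ⟨fun x hx u v =>
        fubiniStudy_eq_of_rescaling hXopen hα hβ hx (hα0 x hx) hω' u v, fun x hx y hy => ?_⟩
      refine norm_dualInner_div_eq_of_rescaling (ω := extendZero ω) ?_ (hα0 x hx) (hα0 y hy)
      rintro a (rfl | rfl) b (rfl | rfl) <;> exact hω' _ ‹_› _ ‹_›
  rw [hσ, hδ₁, hδ₂]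
  tfae_have 1 → 2 := fun h => (hresc h).1
  tfae_have 1 → 3 := fun h => (hresc h).2
  tfae_have 2 → 1 := fun h => hdefect (eventually_rescalingDefect_eq_zero hXopen hα hβ hp
    (hα0 p hp) (hβ0 p hp) fun x hx u => h x hx u u)
  tfae_have 3 → 1 := fun h => hdefect (by
    filter_upwards [hXopen.mem_nhds hp] with x hx
    exact rescalingDefect_self_eq_zero (hα0 p hp) (hβ0 p hp) (hα0 x hx) (hβ0 x hx)
      (h x hx p hp))
  -- Both distance conditions have been rewritten as the same equality of normalized moduli.
  tfae_have 3 ↔ 4 := Iff.rfl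
  tfae_finish
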